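/- Work over $\mathbb{C}$. For a smooth projective variety $X$, let $\mathrm{Pic}(X)$ be the group of divisors modulo linear equivalence, let $M_X\subset \mathrm{Pic}(X)$ be the monoid of classes of effective divisors, and let $$E^1(X)=\sum_{D\in M_X} h^0(X,\mathcal{O}_X(D))\, t^D\in\mathbb{Z}[[M_X]]$$ be its Euler-Chow series in codimension one, where $\mathbb{Z}[[M_X]]$ is the set of all functions $M_X\to\mathbb{Z}$ with the convolution product. A series $f\in\mathbb{Z}[[M_X]]$ is called algebraic if $a_0+a_1f+\cdots+a_df^d=0$ for some $d\ge 0$ and some $a_0,\dots,a_d$ in the monoid ring $\mathbb{Z}[M_X]$, not all zero, and transcendental otherwise. The effective cone $\mathrm{NE}^1(X)$ is the smallest closed convex cone in $\mathrm{Pic}(X)\otimes\mathbb{R}$ containing the classes of all effective divisors. An extreme ray of $\mathrm{NE}^1(X)$ is a face of the form $\mathbb{R}_{\ge 0}v$ with $v\neq 0$. Let $X$ be a smooth projective variety with $\mathrm{Pic}(X)\cong\mathbb{Z}^m$ for some $m\ge 0$. Suppose that infinitely many different extreme rays of $\mathrm{NE}^1(X)$ are generated by classes of effective divisors, i.e.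 are of the form $\mathbb{R}_{\ge 0}[D]$ with $D$ an effective divisor. Then $E^1(X)$ is transcendental. Moreover, for every smooth projective variety $Y$ with a birational morphism $\pi\colon Y\to X$, the series $E^1(Y)$ is transcendental. -/

import Mathlib

open CategoryTheory AlgebraicGeometry TensorProduct

noncomputable section

/-! ### Smooth complex projective varieties -/

/-- The `ℕ`-grading of `ℂ[x₀, …, xₙ]` by degree. -/
abbrev projGrading (n : ℕ) : ℕ → Submodule ℂ (MvPolynomial (Fin (n + 1)) ℂ) :=
  MvPolynomial.homogeneousSubmodule (Fin (n + 1)) ℂ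

instance (n : ℕ) : GradedAlgebra (projGrading n) := MvPolynomial.gradedAlgebra

/-- Projective `n`-space over `ℂ`, as `Proj ℂ[x₀, …, xₙ]`. -/
abbrev complexProjectiveSpace (n : ℕ) : Scheme.{0} := Proj (projGrading n)

/-- The structure morphism `ℙⁿ → Spec ℂ`. -/
def complexProjectiveSpaceStr (n : ℕ) : complexProjectiveSpace n ⟶ Spec (CommRingCat.of ℂ) :=
  Proj.toSpecZero (projGrading n) ≫
    Spec.map (CommRingCat.ofHom (algebraMap ℂ (projGrading n 0)))

/-- A smooth projective variety over `ℂ`: an integral `ℂ`-scheme, smooth over `ℂ`, which admits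
a closed immersion over `ℂ` into some `ℙⁿ`. -/
structure SmoothProjectiveVariety where
  scheme : Scheme.{0}
  str : scheme ⟶ Spec (CommRingCat.of ℂ)
  isIntegral : IsIntegral scheme
  smooth : Smooth str
  projective : ∃ (n : ℕ) (i : scheme ⟶ complexProjectiveSpace n),
    IsClosedImmersion i ∧ i ≫ complexProjectiveSpaceStr n = str

namespace SmoothProjectiveVariety

instance (X : SmoothProjectiveVariety) : IsIntegral X.scheme := X.isIntegral

instance (X : SmoothProjectiveVariety) : Smooth X.str := X.smooth

instance (X : SmoothProjectiveVariety) : IsLocallyNoetherian X.scheme :=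
  LocallyOfFiniteType.isLocallyNoetherian X.str

/-- The field `ℂ(X)` of rational functions on `X`. -/
abbrev RatFunc (X : SmoothProjectiveVariety) : Type := X.scheme.functionField

/-- The field of rational functions is a `ℂ`-algebra through the structure morphism of `X`. -/
instance (X : SmoothProjectiveVariety) : Algebra ℂ X.RatFunc :=
  ((X.scheme.presheaf.germ ⊤ (genericPoint X.scheme) trivial).hom.comp
    (X.str.appTop.hom.comp (Scheme.ΓSpecIso (CommRingCat.of ℂ)).inv.hom)).toAlgebra

/-! ### Divisors, the Picard group and effective classes -/

/-- The prime divisors of `X`, each given by its generic point, a point of codimension one. -/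
abbrev PrimeDivisor (X : SmoothProjectiveVariety) : Type :=
  {x : X.scheme // Order.coheight x = 1}

/-- Divisors on `X`: finite integral combinations of prime divisors. -/
abbrev Divisor (X : SmoothProjectiveVariety) : Type := X.PrimeDivisor →₀ ℤ

/-- The order of vanishing of a rational function along a prime divisor. -/
abbrev ordAlong (X : SmoothProjectiveVariety) (f : X.RatFunc) (z : X.PrimeDivisor) : ℤ :=
  Scheme.ord f z.1

theorem ordAlong_mul (X : SmoothProjectiveVariety) {f g : X.RatFunc} (hf : f ≠ 0) (hg : g ≠ 0)
    (z : X.PrimeDivisor) : X.ordAlong (f * g) z = X.ordAlong f z + X.ordAlong g z :=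
  Scheme.ord_mul hf hg

theorem ordAlong_one (X : SmoothProjectiveVariety) (z : X.PrimeDivisor) :
    X.ordAlong 1 z = 0 := by
  have h := X.ordAlong_mul (one_ne_zero) (one_ne_zero) z
  rw [mul_one] at h
  linarith

theorem ordAlong_inv (X : SmoothProjectiveVariety) {f : X.RatFunc} (hf : f ≠ 0)
    (z : X.PrimeDivisor) : X.ordAlong f⁻¹ z = - X.ordAlong f z := by
  have h := X.ordAlong_mul hf (inv_ne_zero hf) z
  rw [mul_inv_cancel₀ hf, ordAlong_one] at h
  linarith

/-- The group of principal divisors `div f`, for `f` a nonzero rational function. -/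
def principalDivisors (X : SmoothProjectiveVariety) : AddSubgroup X.Divisor where
  carrier := {D | ∃ f : X.RatFunc, f ≠ 0 ∧ ∀ z, D z = X.ordAlong f z}
  zero_mem' := ⟨1, one_ne_zero, fun z => (X.ordAlong_one z).symm⟩
  add_mem' := by
    rintro D D' ⟨f, hf, hD⟩ ⟨g, hg, hD'⟩
    exact ⟨f * g, mul_ne_zero hf hg, fun z => by
      rw [Finsupp.add_apply, hD, hD', X.ordAlong_mul hf hg]⟩
  neg_mem' := by
    rintro D ⟨f, hf, hD⟩
    exact ⟨f⁻¹, inv_ne_zero hf, fun z => by rw [Finsupp.neg_apply, hD, X.ordAlong_inv hf]⟩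

/-- The Picard group of the smooth variety `X`: divisors modulo linear equivalence. -/
abbrev Pic (X : SmoothProjectiveVariety) : Type := X.Divisor ⧸ X.principalDivisors

/-- The class of a divisor in the Picard group. -/
abbrev divClass (X : SmoothProjectiveVariety) : X.Divisor →+ X.Pic :=
  QuotientAddGroup.mk' X.principalDivisors

/-- The monoid of effective divisors. -/
def effectiveDivisors (X : SmoothProjectiveVariety) : AddSubmonoid X.Divisor where
  carrier := {D | 0 ≤ D}
  zero_mem' := le_refl (0 : X.Divisor)
  add_mem' := fun {a b} (h : 0 ≤ a) (h' : 0 ≤ b) => add_nonneg h h'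

/-- The monoid `M = Div₊(X) / ∼` of effective divisors modulo linear equivalence, as a submonoid
of the Picard group. -/
def effectiveMonoid (X : SmoothProjectiveVariety) : AddSubmonoid X.Pic :=
  X.effectiveDivisors.map X.divClass

/-- The space of global sections `H⁰(X, 𝒪_X(D)) = {f ∈ ℂ(X) : f = 0 or div f + D ≥ 0}`.
As `X` is smooth, the orders of vanishing are discrete valuations and this set is already closed
under `ℂ`-linear combinations, so that taking its span adds nothing. -/
def sections (X : SmoothProjectiveVariety) (D : X.Divisor) : Submodule ℂ X.RatFunc :=
  Submodule.span ℂ {f | f ≠ 0 → ∀ z, 0 ≤ X.ordAlong f z + D z}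

theorem sections_le_of_div (X : SmoothProjectiveVariety) {D D' : X.Divisor} {g : X.RatFunc}
    (hg : g ≠ 0) (h : ∀ z, D z = D' z + X.ordAlong g z) :
    (X.sections D).map (LinearMap.mulLeft ℂ g) ≤ X.sections D' := by
  rw [sections, Submodule.map_span, Submodule.span_le]
  rintro _ ⟨f, hf, rfl⟩
  refine Submodule.subset_span fun hne z => ?_
  have hf0 : f ≠ 0 := by
    rintro rfl
    exact hne (by simp)
  have := hf hf0 z
  rw [LinearMap.mulLeft_apply, X.ordAlong_mul hg hf0]
  rw [h z] at this
  linarith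

theorem finrank_sections_eq (X : SmoothProjectiveVariety) {D D' : X.Divisor}
    (h : D - D' ∈ X.principalDivisors) :
    Module.finrank ℂ (X.sections D) = Module.finrank ℂ (X.sections D') := by
  obtain ⟨g, hg, hD⟩ := h
  have h1 : (X.sections D).map (LinearMap.mulLeft ℂ g) = X.sections D' := by
    refine le_antisymm (X.sections_le_of_div hg fun z => ?_) fun f hf => ?_
    · have := hD z
      rw [Finsupp.sub_apply] at this
      linarith
    · have h2 := X.sections_le_of_div (D := D') (D' := D) (inv_ne_zero hg) (fun z => by
        have := hD z
        rw [Finsupp.sub_apply] at this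
        rw [X.ordAlong_inv hg]
        linarith)
      exact ⟨g⁻¹ * f, h2 ⟨f, hf, rfl⟩, by simp [mul_inv_cancel_left₀ hg]⟩
  rw [← h1]
  exact (Submodule.equivMapOfInjective (LinearMap.mulLeft ℂ g)
    (mul_right_injective₀ hg) (X.sections D)).finrank_eq

/-- `h⁰(X, L) = dim H⁰(X, L)` for a class `L` in the Picard group. -/
def h0 (X : SmoothProjectiveVariety) (L : X.Pic) : ℕ :=
  Quotient.liftOn' L (fun D => Module.finrank ℂ (X.sections D)) fun D D' h => by
    rw [QuotientAddGroup.leftRel_apply] at h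
    refine X.finrank_sections_eq ?_
    have h' := X.principalDivisors.neg_mem h
    rwa [neg_add, neg_neg, ← sub_eq_add_neg] at h'

/-- The Euler-Chow series `E¹(X) = ∑_{D ∈ M} h⁰(X, 𝒪(D)) t^D`, an element of `ℤ[[M]]`. -/
def eulerChow (X : SmoothProjectiveVariety) : X.effectiveMonoid → ℤ :=
  fun L => (X.h0 L.1 : ℤ)

/-! ### The effective cone -/

/-- The real vector space `Pic(X) ⊗ ℝ`. -/
abbrev PicReal (X : SmoothProjectiveVariety) : Type := ℝ ⊗[ℤ] X.Pic

/-- `Pic(X) ⊗ ℝ` with its vector space topology (the usual one when it is of finite dimension). -/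
instance (X : SmoothProjectiveVariety) : TopologicalSpace X.PicReal :=
  moduleTopology ℝ X.PicReal

instance (X : SmoothProjectiveVariety) : IsModuleTopology ℝ X.PicReal := ⟨rfl⟩

instance (X : SmoothProjectiveVariety) : ContinuousAdd X.PicReal :=
  IsModuleTopology.toContinuousAdd ℝ X.PicReal

instance (X : SmoothProjectiveVariety) : ContinuousSMul ℝ X.PicReal :=
  IsModuleTopology.toContinuousSMul ℝ X.PicReal

/-- The class of a line bundle in `Pic(X) ⊗ ℝ`. -/
def realClass (X : SmoothProjectiveVariety) (L : X.Pic) : X.PicReal := (1 : ℝ) ⊗ₜ[ℤ] L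

/-- The effective cone `NE¹(X)`: the smallest closed convex cone in `Pic(X) ⊗ ℝ` containing the
classes of all effective divisors. -/
def effectiveCone (X : SmoothProjectiveVariety) : PointedCone ℝ X.PicReal :=
  (PointedCone.hull ℝ (X.realClass '' X.effectiveMonoid)).closure

/-- `R` is an extreme ray of `NE¹(X)` generated by the class of an effective divisor. -/
def IsEffectiveExtremeRay (X : SmoothProjectiveVariety) (R : PointedCone ℝ X.PicReal) : Prop :=
  R.IsFaceOf X.effectiveCone ∧
    ∃ L ∈ X.effectiveMonoid, X.realClass L ≠ 0 ∧ R = PointedCone.hull ℝ {X.realClass L}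

/-- A morphism `π : Y → X` over `ℂ` is birational if it restricts to an isomorphism from a dense
open subset of `Y` onto a dense open subset of `X`. -/
def IsBirationalMorphism {Y X : SmoothProjectiveVariety} (π : Y.scheme ⟶ X.scheme) : Prop :=
  π ≫ X.str = Y.str ∧
    ∃ e : Y.scheme.PartialIso X.scheme, e.iso.hom ≫ e.target.ι = e.source.ι ≫ π

end SmoothProjectiveVariety

/-! ### Formal series indexed by a monoid -/

namespace MonoidSeries

variable {M : Type*} [AddCommMonoid M]

/-- The convolution product on `ℤ[[M]]`, the group of all functions `M → ℤ`, for a monoid `M` in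
which every element has only finitely many decompositions as a sum of two elements. -/
def conv (f g : M → ℤ) : M → ℤ :=
  fun D => ∑ᶠ p : {p : M × M // p.1 + p.2 = D}, f p.1.1 * g p.1.2

open Classical in
/-- The powers of a series for the convolution product. -/
def pow (f : M → ℤ) : ℕ → (M → ℤ)
  | 0 => fun D => if D = 0 then 1 else 0
  | k + 1 => conv f (pow f k)

/-- A series `f` is algebraic if `a₀ + a₁ f + ⋯ + a_d f^d = 0` for some elements
`a₀, …, a_d` of the monoid ring `ℤ[M]`, not all of them zero. -/
def IsAlgebraic (f : M → ℤ) : Prop :=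
  ∃ (d : ℕ) (a : Fin (d + 1) → AddMonoidAlgebra ℤ M),
    (∃ i, a i ≠ 0) ∧ ∑ i, conv (fun D => (a i).coeff D) (pow f i) = 0

/-- A series is transcendental if it is not algebraic. -/
def IsTranscendental (f : M → ℤ) : Prop := ¬ IsAlgebraic f

end MonoidSeries

end

/-!
The classes of `Y` are split into two parts. The push-forward `p : Pic Y → Pic X` sends effective
classes to effective classes, and its kernel is freely generated by the finitely many exceptional
prime divisors, so that a section of `p` gives coordinates `q : Pic Y → ℤᵉ` on that kernel.
Effective classes with a given push-forward have `q` bounded below, because a nonzero section of a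
divisor on `X` can vanish only to bounded order along each exceptional divisor: spaces of sections
are finite-dimensional.

Suppose that `a₀ + a₁ f + ⋯ + a_d f^d = 0` for `f = E¹(Y)`, and let `S` be the finite set of classes
occurring in the `aᵢ`. Each extreme ray `R` of `NE¹(X)` generated by an effective class defines a
face `ρ` of the monoid of effective classes of `X`, consisting of classes on one ray. A nonzero
difference `p x - p y` with `x, y ∈ S` lies on the line spanned by at most two of the rays, so that
infinitely many rays leave one for which no such difference lies in `ρ - ρ`. For this ray choose
`s ∈ S` minimal modulo `ρ` with respect to effectivity. In the degrees `p s + ρ` the relation then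
involves only the terms of the `aᵢ` over `p s` and the restriction of `f` to `p⁻¹(ρ)`. Recording
`ρ` by the exponent of one variable and `q` by exponents of a Hahn series, this restriction
becomes a power series over a domain that satisfies a nonzero polynomial equation over that domain.
Such a power series is constant (`PowerSeries.exists_eq_C_of_aeval_eq_zero`), whereas an effective
class over the generator of `R` contributes the nonzero coefficient `h⁰` in positive degree. This
argument is `MonoidSeries.isTranscendental_of_faces`.

The geometric input is as follows.

* Smooth algebras over a field are integrally closed (`isIntegrallyClosed_of_smooth`), so that the
  local rings at prime divisors are discrete valuation rings, and a rational function without poles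
  on an affine open set is regular there (`SmoothProjectiveVariety.exists_germToFunctionField_eq`).
* In homogeneous coordinates, sections of a divisor embed into a space of rational functions that
  behave like forms of a fixed degree. These spaces are finite-dimensional since integral closures
  of domains of finite type are finite (`finite_formsOfDegree`), which gives
  `SmoothProjectiveVariety.finite_sections`.
* For a birational morphism `Y ⟶ X`, a discrete valuation ring `𝒪_{X,x}` is maximal for domination,
  hence every prime divisor of `X` comes from one of `Y` with the same order of vanishing, and all
  but finitely many prime divisors of `Y` arise in this way
  (`SmoothProjectiveVariety.IsBirationalMorphism.nonempty_primeDivisorTransfer`).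
-/

/-! ### Algebraic power series over a domain -/

/-- A power series over a domain `A` that is a root of a nonzero polynomial with coefficients in
`A` (not in `A⟦X⟧`) is constant. After a Taylor shift the constant coefficient is `0`; if the
series were nonzero, the shifted polynomial divided by the largest power of the variable would
still vanish at it, and its constant coefficient would be `0`. -/
theorem PowerSeries.exists_eq_C_of_aeval_eq_zero {A : Type*} [CommRing A] [IsDomain A]
    {F : PowerSeries A} {P : Polynomial A} (hP : P ≠ 0) (h : Polynomial.aeval F P = 0) :
    F = PowerSeries.C (PowerSeries.constantCoeff F) := by
  set c := PowerSeries.constantCoeff F with hc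
  by_contra hF
  have hg : F - PowerSeries.C c ≠ 0 := sub_ne_zero.mpr hF
  set Q := Polynomial.taylor c P with hQ
  have hQ0 : Q ≠ 0 := by simpa [hQ] using hP
  have hQF : Polynomial.aeval (F - PowerSeries.C c) Q = 0 := by
    rw [hQ, Polynomial.taylor_apply, Polynomial.aeval_comp]
    simpa using h
  obtain ⟨R, hR, hX⟩ := Polynomial.exists_eq_pow_rootMultiplicity_mul_and_not_dvd Q hQ0 0
  rw [hR, map_mul, map_pow, map_sub, Polynomial.aeval_X, map_zero, map_zero, sub_zero] at hQF
  have hR0 := (mul_eq_zero.mp hQF).resolve_left (pow_ne_zero _ hg)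
  apply hX
  rw [map_zero, sub_zero, Polynomial.X_dvd_iff]
  have h1 := congrArg PowerSeries.constantCoeff hR0
  rw [Polynomial.aeval_def, Polynomial.hom_eval₂] at h1
  have h2 : PowerSeries.constantCoeff (F - PowerSeries.C c) = 0 := by simp [hc]
  rw [h2, Polynomial.eval₂_at_zero] at h1
  simpa using h1

section

open MonoidSeries

/-! ### Series graded by a face -/

theorem isPWO_toLex_image_Ici {e : ℕ} (b : Fin e → ℤ) : (toLex '' Set.Ici b).IsPWO := by
  refine Set.IsPWO.image_of_monotone ?_ Pi.toLex_monotone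
  have h : Set.Ici b ⊆ (fun (n : Fin e → ℕ) i => b i + n i) '' Set.univ := by
    intro x hx
    refine ⟨fun i => (x i - b i).toNat, trivial, funext fun i => ?_⟩
    have : b i ≤ x i := hx i
    simp only
    omega
  refine Set.IsPWO.mono (Set.IsPWO.image_of_monotone (Set.isPWO_of_wellQuasiOrderedLE _)
    fun x y hxy i => ?_) h
  have : x i ≤ y i := hxy i
  simp only
  omega

namespace FaceSeries

/-- The data by which functions on the part of a monoid `M` over a face become power series over a
ring of Hahn series: the elements of `M` lying over the face `ρ` are determined by a degree in `ℕ`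
and a tuple of integers. -/
structure Grading {G H : Type*} [AddCommGroup G] [AddCommGroup H] (M : AddSubmonoid G) (e : ℕ) where
  /-- The projection onto the group containing the face. -/
  p : G →+ H
  /-- The coordinates on the fibres of the projection. -/
  q : G →+ (Fin e → ℤ)
  /-- A monoid containing the image of `M`. -/
  N : AddSubmonoid H
  /-- The face of `N`; it need not be contained in `N`. -/
  ρ : AddSubmonoid H
  /-- The degree along the face. -/
  d : H →+ ℤ
  eq_zero : ∀ x, p x = 0 → q x = 0 → x = 0
  mem_N : ∀ x ∈ M, p x ∈ N
  bdd : ∀ h, ∃ b, ∀ x ∈ M, p x = h → b ≤ q x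
  d_nonneg : ∀ x ∈ ρ, 0 ≤ d x
  d_inj : ∀ x ∈ ρ, ∀ y ∈ ρ, d x = d y → x = y
  face : ∀ x ∈ N, ∀ y ∈ N, x + y ∈ ρ → x ∈ ρ

variable {G H : Type*} [AddCommGroup G] [AddCommGroup H] {M : AddSubmonoid G} {e : ℕ}
  (g : Grading (H := H) M e)

/-- The elements of `M` lying over the face in degree `k`. They all have the same image under `p`.
-/
def Grading.level (k : ℕ) : Set M := {x | g.p x ∈ g.ρ ∧ g.d (g.p x) = k}

theorem Grading.level_inj {k : ℕ} {x y : M} (hx : x ∈ g.level k) (hy : y ∈ g.level k)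
    (h : g.q x = g.q y) : x = y := by
  have hp : g.p x = g.p y := g.d_inj _ hx.1 _ hy.1 (hx.2.trans hy.2.symm)
  refine Subtype.ext (sub_eq_zero.mp (g.eq_zero _ ?_ ?_))
  · rw [map_sub, hp, sub_self]
  · rw [map_sub, h, sub_self]

theorem Grading.exists_le (k : ℕ) : ∃ b, ∀ x ∈ g.level k, b ≤ g.q x := by
  by_cases h : ∃ x, x ∈ g.level k
  · obtain ⟨x, hx⟩ := h
    obtain ⟨b, hb⟩ := g.bdd (g.p x)
    exact ⟨b, fun y hy => hb y y.2 (g.d_inj _ hy.1 _ hx.1 (hy.2.trans hx.2.symm))⟩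
  · exact ⟨0, fun x hx => (h ⟨x, hx⟩).elim⟩

/-- The values of `f` in degree `k`, as a Hahn series in the coordinates `q`. The lexicographic
order makes `ℤᵉ` a linearly ordered group, so that the ring of these Hahn series is a domain; the
support is well-ordered since `q` is bounded below in each degree. -/
noncomputable def Grading.coeffs (f : M → ℤ) (k : ℕ) : HahnSeries (Lex (Fin e → ℤ)) ℤ where
  coeff := Function.extend (fun x : g.level k => toLex (g.q x)) (fun x => f x) 0
  isPWO_support' := by
    obtain ⟨b, hb⟩ := g.exists_le k
    refine (isPWO_toLex_image_Ici b).mono fun γ hγ => ?_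
    by_contra hcon
    refine hγ (Function.extend_apply' _ _ _ ?_)
    rintro ⟨x, rfl⟩
    exact hcon ⟨_, hb _ x.2, rfl⟩

theorem Grading.coeff_coeffs (f : M → ℤ) (k : ℕ) : (g.coeffs f k).coeff =
    Function.extend (fun x : g.level k => toLex (g.q x)) (fun x => f x) 0 := rfl

theorem Grading.coeffs_apply (f : M → ℤ) {k : ℕ} {x : M} (hx : x ∈ g.level k) :
    (g.coeffs f k).coeff (toLex (g.q x)) = f x :=
  Function.Injective.extend_apply (f := fun x : g.level k => toLex (g.q x))
    (fun x y h => Subtype.ext (g.level_inj x.2 y.2 (toLex.injective h))) (fun x => f x) 0 ⟨x, hx⟩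

theorem Grading.exists_of_coeffs_ne_zero {f : M → ℤ} {k : ℕ} {γ : Lex (Fin e → ℤ)}
    (h : (g.coeffs f k).coeff γ ≠ 0) : ∃ x ∈ g.level k, toLex (g.q x) = γ ∧ f x ≠ 0 := by
  by_contra! hcon
  by_cases hx : ∃ x : g.level k, toLex (g.q x) = γ
  · obtain ⟨x, rfl⟩ := hx
    exact h ((g.coeffs_apply f x.2).trans (hcon x x.2 rfl))
  · exact h (by rw [g.coeff_coeffs]; exact Function.extend_apply' _ _ _ hx)

/-- The restriction of `f` to the part of `M` over the face, as a power series in the degree. -/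
noncomputable def Grading.series (f : M → ℤ) : PowerSeries (HahnSeries (Lex (Fin e → ℤ)) ℤ) :=
  PowerSeries.mk (g.coeffs f)

/-- The face property: decompositions of an element over the face stay over the face. -/
theorem Grading.level_of_add {k : ℕ} {x y : M} (h : x + y ∈ g.level k) :
    ∃ i j, i + j = k ∧ x ∈ g.level i ∧ y ∈ g.level j := by
  have h1 : g.p x + g.p y ∈ g.ρ := by
    have := h.1
    rwa [AddSubmonoid.coe_add, map_add] at this
  have hx := g.face _ (g.mem_N x x.2) _ (g.mem_N y y.2) h1
  have hy := g.face _ (g.mem_N y y.2) _ (g.mem_N x x.2) (add_comm (g.p x) _ ▸ h1)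
  obtain ⟨i, hi⟩ := Int.eq_ofNat_of_zero_le (g.d_nonneg _ hx)
  obtain ⟨j, hj⟩ := Int.eq_ofNat_of_zero_le (g.d_nonneg _ hy)
  refine ⟨i, j, ?_, ⟨hx, hi⟩, ⟨hy, hj⟩⟩
  have h2 := h.2
  rw [AddSubmonoid.coe_add, map_add, map_add, hi, hj] at h2
  exact_mod_cast h2

theorem Grading.add_mem_level {i j : ℕ} {x y : M} (hx : x ∈ g.level i) (hy : y ∈ g.level j) :
    x + y ∈ g.level (i + j) := by
  refine ⟨?_, ?_⟩
  · rw [AddSubmonoid.coe_add, map_add]; exact add_mem hx.1 hy.1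
  · rw [AddSubmonoid.coe_add, map_add, map_add, hx.2, hy.2, Nat.cast_add]

/-- Restriction to a face is multiplicative. In both products the summands with nonzero value
correspond to the decompositions `D = y + z` with `f y * f' z ≠ 0`; in particular there are only
finitely many, so that the `finsum` defining `conv` takes no default value. -/
theorem Grading.series_conv (f f' : M → ℤ) :
    g.series (conv f f') = g.series f * g.series f' := by
  ext k γ
  rw [PowerSeries.coeff_mul]
  simp only [series, PowerSeries.coeff_mk]
  rw [HahnSeries.coeff_sum]
  simp_rw [HahnSeries.coeff_mul]
  rw [Finset.sum_sigma']
  set S := (Finset.HasAntidiagonal.antidiagonal k).sigma fun x =>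
    Finset.antidiagonal (g.coeffs f x.1).isPWO_support (g.coeffs f' x.2).isPWO_support γ with hS
  set Φ : (Σ _ : ℕ × ℕ, Lex (Fin e → ℤ) × Lex (Fin e → ℤ)) → ℤ := fun x =>
    (g.coeffs f x.1.1).coeff x.2.1 * (g.coeffs f' x.1.2).coeff x.2.2 with hΦ
  -- A nonzero summand of the product of power series comes from a decomposition in `M`.
  have key : ∀ x ∈ S, Φ x ≠ 0 → ∃ y z : M, y ∈ g.level x.1.1 ∧ z ∈ g.level x.1.2 ∧
      y + z ∈ g.level k ∧ toLex (g.q (y + z)) = γ ∧ toLex (g.q y) = x.2.1 ∧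
        toLex (g.q z) = x.2.2 := by
    rintro ⟨⟨i, j⟩, ⟨α, β⟩⟩ hx hne
    obtain ⟨hij, hαβ⟩ := Finset.mem_sigma.mp hx
    have hij : i + j = k := Finset.HasAntidiagonal.mem_antidiagonal.mp hij
    have hαβ : α + β = γ := (Finset.mem_antidiagonal.mp hαβ).2.2
    obtain ⟨y, hy, hyα, -⟩ := g.exists_of_coeffs_ne_zero (left_ne_zero_of_mul hne)
    obtain ⟨z, hz, hzβ, -⟩ := g.exists_of_coeffs_ne_zero (right_ne_zero_of_mul hne)
    refine ⟨y, z, hy, hz, hij ▸ g.add_mem_level hy hz, ?_, hyα, hzβ⟩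
    rw [map_add, toLex_add, hyα, hzβ]
    exact hαβ
  by_cases hD : ∃ D ∈ g.level k, toLex (g.q D) = γ
  · obtain ⟨D, hD, rfl⟩ := hD
    rw [g.coeffs_apply _ hD]
    have e1 : ∑ x ∈ S, Φ x = ∑ᶠ x ∈ (S : Set _) ∩ Function.support Φ, Φ x := by
      rw [finsum_mem_inter_support, finsum_mem_coe_finset]
    change _ = ∑ x ∈ S, Φ x
    rw [e1, conv, ← finsum_mem_support]
    let d' : M → ℕ := fun x => (g.d (g.p x)).toNat
    have hd' : ∀ {i : ℕ} {x : M}, x ∈ g.level i → d' x = i := fun {i x} hx => by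
      simp only [d', hx.2, Int.toNat_natCast]
    have hterm : ∀ {i j : ℕ} {y z : M}, y ∈ g.level i → z ∈ g.level j →
        Φ ⟨(d' y, d' z), (toLex (g.q y), toLex (g.q z))⟩ = f y * f' z := fun {i j y z} hy hz => by
      simp only [hΦ, hd' hy, hd' hz, g.coeffs_apply _ hy, g.coeffs_apply _ hz]
    refine finsum_mem_eq_of_bijOn
      (fun x : {x : M × M // x.1 + x.2 = D} =>
        ⟨(d' x.1.1, d' x.1.2), (toLex (g.q x.1.1), toLex (g.q x.1.2))⟩) ⟨?_, ?_, ?_⟩ ?_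
    · rintro ⟨⟨y, z⟩, hyz⟩ hne
      obtain ⟨i, j, hij, hy, hz⟩ := g.level_of_add (hyz ▸ hD)
      have ht := hterm hy hz
      have hne' : f y * f' z ≠ 0 := hne
      refine ⟨?_, by rwa [Function.mem_support, ht]⟩
      rw [hS, Finset.mem_coe, Finset.mem_sigma]
      refine ⟨Finset.HasAntidiagonal.mem_antidiagonal.mpr (by simp only [hd' hy, hd' hz, hij]), ?_⟩
      rw [Finset.mem_antidiagonal]
      simp only [HahnSeries.mem_support, hd' hy, hd' hz, g.coeffs_apply _ hy, g.coeffs_apply _ hz]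
      refine ⟨left_ne_zero_of_mul hne', right_ne_zero_of_mul hne', ?_⟩
      rw [← toLex_add, ← map_add, ← hyz, AddSubmonoid.coe_add]
    · rintro ⟨⟨y, z⟩, hyz⟩ _ ⟨⟨y', z'⟩, hyz'⟩ _ heq
      simp only [Sigma.mk.injEq, Prod.mk.injEq, heq_eq_eq] at heq
      obtain ⟨i, j, hij, hy, hz⟩ := g.level_of_add (hyz ▸ hD)
      obtain ⟨i', j', hij', hy', hz'⟩ := g.level_of_add (hyz' ▸ hD)
      rw [hd' hy, hd' hz, hd' hy', hd' hz'] at heq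
      obtain ⟨⟨rfl, rfl⟩, h1, h2⟩ := heq
      have := g.level_inj hy hy' (toLex.injective h1)
      have := g.level_inj hz hz' (toLex.injective h2)
      simp_all
    · rintro x ⟨hxS, hx⟩
      obtain ⟨y, z, hy, hz, hyz, hq, h1, h2⟩ := key x hxS hx
      have hyz' : y + z = D := g.level_inj hyz hD (toLex.injective hq)
      have hx' : (⟨(d' y, d' z), (toLex (g.q y), toLex (g.q z))⟩ :
          Σ _ : ℕ × ℕ, Lex (Fin e → ℤ) × Lex (Fin e → ℤ)) = x := by
        rw [hd' hy, hd' hz, h1, h2]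
      refine ⟨⟨(y, z), hyz'⟩, ?_, hx'⟩
      change f y * f' z ≠ 0
      rw [← hterm hy hz, hx']
      exact hx
    · rintro ⟨⟨y, z⟩, hyz⟩ hne
      obtain ⟨i, j, hij, hy, hz⟩ := g.level_of_add (hyz ▸ hD)
      exact (hterm hy hz).symm
  · have h0 : (g.coeffs (conv f f') k).coeff γ = 0 := by
      by_contra hne
      obtain ⟨x, hx, hγ, -⟩ := g.exists_of_coeffs_ne_zero hne
      exact hD ⟨x, hx, hγ⟩
    rw [h0]
    refine (Finset.sum_eq_zero fun x hx => ?_).symm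
    by_contra hne
    obtain ⟨y, z, -, -, h1, h2, -⟩ := key x hx hne
    exact hD ⟨_, h1, h2⟩

theorem Grading.series_pow (f : M → ℤ) (n : ℕ) : g.series (pow f n) = g.series f ^ n := by
  induction n with
  | succ n ih => rw [pow_succ', ← ih, ← g.series_conv]; rfl
  | zero =>
    rw [pow_zero]
    ext k γ
    rw [series, PowerSeries.coeff_mk, PowerSeries.coeff_one]
    have h0 : (0 : M) ∈ g.level 0 := by
      refine ⟨?_, ?_⟩
      · rw [AddSubmonoid.coe_zero, map_zero]; exact zero_mem _
      · rw [AddSubmonoid.coe_zero, map_zero, map_zero, Nat.cast_zero]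
    have hq0 : toLex (g.q (0 : M)) = 0 := by
      rw [AddSubmonoid.coe_zero, map_zero]; rfl
    by_cases hk : k = 0 ∧ γ = 0
    · obtain ⟨rfl, rfl⟩ := hk
      have := g.coeffs_apply (pow f 0) h0
      rw [hq0] at this
      rw [this, if_pos rfl, HahnSeries.coeff_one, if_pos rfl]
      exact if_pos rfl
    · have h1 : (if k = 0 then (1 : HahnSeries (Lex (Fin e → ℤ)) ℤ) else 0).coeff γ = 0 := by
        split_ifs with h
        · rw [HahnSeries.coeff_one, if_neg fun h' => hk ⟨h, h'⟩]
        · rfl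
      rw [h1]
      by_contra hne
      obtain ⟨x, hx, hγ, hfx⟩ := g.exists_of_coeffs_ne_zero hne
      have hx0 : x = 0 := by
        by_contra h
        exact hfx (if_neg h)
      subst hx0
      refine hk ⟨?_, hγ.symm.trans hq0⟩
      have := hx.2
      rw [AddSubmonoid.coe_zero, map_zero, map_zero] at this
      exact_mod_cast this.symm

open Classical in
/-- The product of an element of the monoid ring with a series, as a sum over the support of the
former: `M` is cancellative, so that `y` is determined by `x + y = D`. -/
theorem conv_coeff_eq_sum (a : AddMonoidAlgebra ℤ M) (f : M → ℤ) (D : M)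
    {S : Finset M} (hS : a.coeff.support ⊆ S) :
    conv (fun x => a.coeff x) f D =
      ∑ x ∈ S, a.coeff x * (if h : ∃ y, x + y = D then f h.choose else 0) := by
  set F : M → ℤ := fun x => a.coeff x * (if h : ∃ y, x + y = D then f h.choose else 0) with hF
  have hinj : Function.Injective fun u : {u : M × M // u.1 + u.2 = D} => u.1.1 := by
    rintro ⟨⟨x, y⟩, h⟩ ⟨⟨x', y'⟩, h'⟩ (rfl : x = x')
    have : y = y' := by
      have : x + y = x + y' := h.trans h'.symm
      exact add_left_cancel this
    subst this
    rfl
  have h1 : conv (fun x => a.coeff x) f D =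
      ∑ᶠ u : {u : M × M // u.1 + u.2 = D}, F u.1.1 := by
    refine finsum_congr ?_
    rintro ⟨⟨x, y⟩, h⟩
    have hex : ∃ y, x + y = D := ⟨y, h⟩
    have : hex.choose = y := by
      have : x + hex.choose = x + y := hex.choose_spec.trans h.symm
      exact add_left_cancel this
    simp only [hF, dif_pos hex, this]
  rw [h1, ← finsum_mem_range (f := F) hinj]
  refine finsum_mem_eq_sum_of_inter_support_eq F (Set.ext fun x => ⟨?_, ?_⟩)
  · rintro ⟨-, hx⟩
    exact ⟨hS (Finsupp.mem_support_iff.mpr (left_ne_zero_of_mul hx)), hx⟩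
  · rintro ⟨-, hx⟩
    refine ⟨?_, hx⟩
    by_contra hcon
    refine right_ne_zero_of_mul hx (dif_neg ?_)
    rintro ⟨y, hy⟩
    exact hcon ⟨⟨(x, y), hy⟩, rfl⟩

/-- The terms of `a` with the same image under `p` as `s`, translated by `-s` and written as a Hahn
series in the coordinates `q`. -/
noncomputable def Grading.initialForm (s : M) (a : AddMonoidAlgebra ℤ M) :
    HahnSeries (Lex (Fin e → ℤ)) ℤ := by
  classical
  exact ∑ x ∈ a.coeff.support.filter fun x : M => g.p x = g.p s,
    HahnSeries.single (toLex (g.q x - g.q s)) (a.coeff x)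

open Classical in
theorem Grading.initialForm_eq (s : M) (a : AddMonoidAlgebra ℤ M) {S : Finset M}
    (hS : a.coeff.support ⊆ S) : g.initialForm s a = ∑ x ∈ S.filter fun x : M => g.p x = g.p s,
    HahnSeries.single (toLex (g.q x - g.q s)) (a.coeff x) := by
  rw [initialForm]
  refine Finset.sum_subset_zero_on_sdiff (Finset.filter_subset_filter _ hS) ?_ fun _ _ => by
    congr
  intro x hx
  rw [Finset.mem_sdiff, Finset.mem_filter, Finset.mem_filter] at hx
  have : a.coeff x = 0 := by
    by_contra h
    exact hx.2 ⟨Finsupp.mem_support_iff.mpr h, hx.1.2⟩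
  rw [this, HahnSeries.single_eq_zero]

theorem Grading.initialForm_ne_zero {s : M} {a : AddMonoidAlgebra ℤ M}
    (hs : a.coeff s ≠ 0) : g.initialForm s a ≠ 0 := by
  classical
  intro h
  have h1 := congrArg (fun F => HahnSeries.coeff F 0) h
  rw [g.initialForm_eq s a subset_rfl] at h1
  simp only [HahnSeries.coeff_sum, HahnSeries.coeff_zero] at h1
  rw [Finset.sum_eq_single s] at h1
  · rw [sub_self, toLex_zero, HahnSeries.coeff_single_same] at h1
    exact hs h1
  · intro x hx hne
    refine HahnSeries.coeff_single_of_ne fun h0 => hne ?_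
    have h2 : g.q x - g.q s = 0 := toLex.injective h0.symm
    refine Subtype.ext (sub_eq_zero.mp (g.eq_zero _ ?_ ?_))
    · rw [map_sub, (Finset.mem_filter.mp hx).2, sub_self]
    · rw [map_sub, h2]
  · intro hns
    exact (hns (Finset.mem_filter.mpr ⟨Finsupp.mem_support_iff.mpr hs, rfl⟩)).elim

/-- A finite set has a minimal element for the preorder in which `x ≤ y` if `p y - p x` belongs to
`N - ρ`. -/
theorem Grading.exists_minimal (S : Finset M) (hS : S.Nonempty) : ∃ s ∈ S, ∀ x ∈ S,
    (∃ r ∈ g.ρ, g.p s - g.p x + r ∈ g.N) → ∃ r ∈ g.ρ, g.p x - g.p s + r ∈ g.N := by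
  let : Preorder M :=
    { le := fun x y => ∃ r ∈ g.ρ, g.p y - g.p x + r ∈ g.N
      le_refl := fun x => ⟨0, zero_mem _, by rw [sub_self, add_zero]; exact zero_mem _⟩
      le_trans := by
        rintro x y z ⟨r, hr, h⟩ ⟨r', hr', h'⟩
        refine ⟨r + r', add_mem hr hr', ?_⟩
        have := add_mem h h'
        convert this using 1
        abel }
  obtain ⟨s, hs⟩ := Finset.exists_minimal hS
  exact ⟨s, hs.1, fun x hx h => hs.2 hx h⟩

/-- In a degree of the form `p s + r` with `r` on the face, the terms of `a` over `p s` are the only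
ones that contribute to the product of `a` and `f`. -/
theorem Grading.coeff_initialForm_mul {s : M} {a : AddMonoidAlgebra ℤ M} {f : M → ℤ}
    {k : ℕ} {γ : Lex (Fin e → ℤ)} {S : Finset M} (hS : a.coeff.support ⊆ S)
    (hmin : ∀ x ∈ S, ∀ y : M, ∀ r ∈ g.ρ, g.p x + g.p y = g.p s + r → g.p x = g.p s)
    {D r : M} (hr : r ∈ g.level k) (hD : g.p D = g.p s + g.p r)
    (hq : g.q D = ofLex γ + g.q s) :
    (g.initialForm s a * g.coeffs f k).coeff γ = conv (fun x => a.coeff x) f D := by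
  classical
  rw [conv_coeff_eq_sum a f D hS, g.initialForm_eq s a hS, Finset.sum_mul, HahnSeries.coeff_sum,
    Finset.sum_filter]
  refine Finset.sum_congr rfl fun x hx => ?_
  split_ifs with hp h h
  · have hy := h.choose_spec
    set y := h.choose
    have hpy : g.p y = g.p r := by
      have := congrArg (fun z : M => g.p z) hy
      simp only [AddSubmonoid.coe_add, map_add, hD, hp] at this
      exact add_left_cancel this
    have hly : y ∈ g.level k := ⟨hpy ▸ hr.1, hpy ▸ hr.2⟩
    have hγ : γ = toLex (g.q x - g.q s) + toLex (g.q y) := by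
      have := congrArg (fun z : M => g.q z) hy
      simp only [AddSubmonoid.coe_add, map_add, hq] at this
      rw [← toLex_add]
      apply ofLex.injective
      rw [ofLex_toLex, sub_add_eq_add_sub, this, add_sub_cancel_right]
    rw [hγ, add_comm, HahnSeries.coeff_single_mul_add, g.coeffs_apply f hly]
  · rw [mul_zero]
    have hγ : γ = (γ - toLex (g.q x - g.q s)) + toLex (g.q x - g.q s) := by abel
    rw [hγ, HahnSeries.coeff_single_mul_add]
    have : (g.coeffs f k).coeff (γ - toLex (g.q x - g.q s)) = 0 := by
      by_contra hne
      obtain ⟨y, hy, hyq, -⟩ := g.exists_of_coeffs_ne_zero hne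
      refine h ⟨y, Subtype.ext (sub_eq_zero.mp (g.eq_zero _ ?_ ?_))⟩
      · rw [AddSubmonoid.coe_add, map_sub, map_add, hD, hp,
          g.d_inj _ hy.1 _ hr.1 (hy.2.trans hr.2.symm), sub_self]
      · have h1 : g.q y = ofLex γ - (g.q x - g.q s) := by
          rw [← ofLex_toLex (g.q y), hyq]; rfl
        rw [AddSubmonoid.coe_add, map_sub, map_add, hq, h1]
        abel
    rw [this, mul_zero]
  · refine (hp (hmin x hx h.choose _ hr.1 ?_)).elim
    have := congrArg (fun z : M => g.p z) h.choose_spec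
    simp only [AddSubmonoid.coe_add, map_add, hD] at this
    exact this
  · simp

/-- A relation between the powers of `f` with coefficients in the monoid ring yields the relation
between the powers of the restriction of `f` to the face whose coefficients are the initial forms at
a minimal element `s`. -/
theorem Grading.sum_initialForm_mul_series {s : M} {n : ℕ} {a : Fin (n + 1) → AddMonoidAlgebra ℤ M}
    {f : M → ℤ} {S : Finset M} (hS : ∀ i, (a i).coeff.support ⊆ S)
    (hmin : ∀ x ∈ S, ∀ y : M, ∀ r ∈ g.ρ, g.p x + g.p y = g.p s + r → g.p x = g.p s)
    (ha : ∑ i, conv (fun D => (a i).coeff D) (pow f i) = 0) :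
    ∑ i : Fin (n + 1), PowerSeries.C (g.initialForm s (a i)) * g.series f ^ (i : ℕ) = 0 := by
  classical
  ext k γ
  simp only [← g.series_pow, map_sum, PowerSeries.coeff_C_mul, HahnSeries.coeff_sum, map_zero,
    HahnSeries.coeff_zero]
  simp only [series, PowerSeries.coeff_mk]
  by_cases hD : ∃ D r : M, r ∈ g.level k ∧ g.p D = g.p s + g.p r ∧ g.q D = ofLex γ + g.q s
  · obtain ⟨D, r, hr, hp, hq⟩ := hD
    rw [Finset.sum_congr rfl fun (i : Fin (n + 1)) _ =>
      g.coeff_initialForm_mul (f := pow f (i : ℕ)) (hS i) hmin hr hp hq]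
    have := congrFun ha D
    rwa [Finset.sum_apply] at this
  · refine Finset.sum_eq_zero fun i _ => ?_
    rw [g.initialForm_eq s (a i) (hS i), Finset.sum_mul, HahnSeries.coeff_sum]
    refine Finset.sum_eq_zero fun x hx => ?_
    have hγ : γ = (γ - toLex (g.q x - g.q s)) + toLex (g.q x - g.q s) := by abel
    rw [hγ, HahnSeries.coeff_single_mul_add]
    by_contra hne
    obtain ⟨y, hy, hyq, -⟩ := g.exists_of_coeffs_ne_zero (right_ne_zero_of_mul hne)
    refine hD ⟨x + y, y, hy, ?_, ?_⟩
    · rw [AddSubmonoid.coe_add, map_add, (Finset.mem_filter.mp hx).2]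
    · have h1 : g.q y = ofLex γ - (g.q x - g.q s) := by
        rw [← ofLex_toLex (g.q y), hyq]; rfl
      rw [AddSubmonoid.coe_add, map_add, h1]
      abel

end FaceSeries

/-- A series `f` is transcendental if for every finite set `T` of nonzero elements of `H` the image
of `M` has a one-dimensional face `ρ` with `ρ - ρ` disjoint from `T` such that `f` is nonzero at an
element of positive degree over `ρ`. -/
theorem MonoidSeries.isTranscendental_of_faces {G H : Type*} [AddCommGroup G] [AddCommGroup H]
    {M : AddSubmonoid G} {e : ℕ} {f : M → ℤ} (p : G →+ H) (q : G →+ (Fin e → ℤ))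
    (N : AddSubmonoid H) (heq : ∀ x, p x = 0 → q x = 0 → x = 0) (hN : ∀ x ∈ M, p x ∈ N)
    (hbdd : ∀ h, ∃ b, ∀ x ∈ M, p x = h → b ≤ q x)
    (hface : ∀ T : Finset H, 0 ∉ T → ∃ (ρ : AddSubmonoid H) (d : H →+ ℤ),
      (∀ x ∈ ρ, 0 ≤ d x) ∧ (∀ x ∈ ρ, ∀ y ∈ ρ, d x = d y → x = y) ∧
      (∀ x ∈ N, ∀ y ∈ N, x + y ∈ ρ → x ∈ ρ) ∧ (∀ x ∈ ρ, ∀ y ∈ ρ, x - y ∉ T) ∧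
        ∃ D : M, p D ∈ ρ ∧ p D ≠ 0 ∧ f D ≠ 0) :
    IsTranscendental f := by
  classical
  rintro ⟨n, a, ⟨i₀, hi₀⟩, ha⟩
  set S : Finset M := Finset.univ.biUnion fun i => (a i).coeff.support with hS
  have hSi : ∀ i, (a i).coeff.support ⊆ S := fun i =>
    Finset.subset_biUnion_of_mem (fun i => (a i).coeff.support) (Finset.mem_univ i)
  have hSne : S.Nonempty := by
    have : (a i₀).coeff ≠ 0 := fun h => hi₀ (by ext x; rw [h]; rfl)
    obtain ⟨x, hx⟩ := Finsupp.support_nonempty_iff.mpr this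
    exact ⟨x, hSi i₀ hx⟩
  -- The set to be avoided consists of the nonzero differences of images of exponents.
  obtain ⟨ρ, d, hd, hinj, hfac, hT, D, hDρ, hD0, hfD⟩ :=
    hface (((S ×ˢ S).image fun u => p u.1 - p u.2).erase 0) (Finset.notMem_erase _ _)
  let g : FaceSeries.Grading (H := H) M e := ⟨p, q, N, ρ, d, heq, hN, hbdd, hd, hinj, hfac⟩
  obtain ⟨s, hs, hsmin⟩ := g.exists_minimal S hSne
  have hmin : ∀ x ∈ S, ∀ y : M, ∀ r ∈ g.ρ, g.p x + g.p y = g.p s + r → g.p x = g.p s := by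
    intro x hx y r hr hxy
    obtain ⟨r', hr', h'⟩ := hsmin x hx ⟨r, hr, by
      rw [sub_add_eq_add_sub, ← hxy, add_sub_cancel_left]
      exact hN y y.2⟩
    -- `p y` is a summand of an element of the face, hence `p x - p s` is a difference in `ρ - ρ`.
    have hy : g.p y ∈ g.ρ := by
      refine g.face _ (hN y y.2) _ h' ?_
      have : g.p y + (g.p x - g.p s + r') = r + r' := by
        rw [add_comm (g.p x)] at hxy
        rw [← add_assoc, add_sub_assoc', hxy, add_sub_cancel_left]
      rw [this]
      exact add_mem hr hr'
    have h2 : p x - p s = r - p y := by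
      rw [sub_eq_sub_iff_add_eq_add]
      exact hxy.trans (add_comm _ _)
    by_contra hne
    refine hT r hr _ hy ?_
    rw [← h2, Finset.mem_erase]
    exact ⟨sub_ne_zero.mpr hne, Finset.mem_image.mpr ⟨(x, s), Finset.mk_mem_product hx hs, rfl⟩⟩
  have hsum := g.sum_initialForm_mul_series hSi hmin ha
  set P : Polynomial (HahnSeries (Lex (Fin e → ℤ)) ℤ) :=
    ∑ i : Fin (n + 1), Polynomial.monomial i (g.initialForm s (a i)) with hP
  have hP0 : P ≠ 0 := by
    obtain ⟨i, -, hi⟩ := Finset.mem_biUnion.mp hs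
    intro h0
    have h1 := congrArg (fun Q => Polynomial.coeff Q i) h0
    simp only [hP, Polynomial.finsetSum_coeff, Polynomial.coeff_zero,
      Polynomial.coeff_monomial] at h1
    rw [Finset.sum_eq_single i, if_pos rfl] at h1
    · exact g.initialForm_ne_zero (Finsupp.mem_support_iff.mp hi) h1
    · exact fun j _ hj => if_neg fun h => hj (Fin.ext h)
    · exact fun h => (h (Finset.mem_univ i)).elim
  have hPF : Polynomial.aeval (g.series f) P = 0 := by
    rw [hP, map_sum]
    simp only [Polynomial.aeval_monomial]
    exact hsum
  have hconst := PowerSeries.exists_eq_C_of_aeval_eq_zero hP0 hPF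
  obtain ⟨k, hk⟩ := Int.eq_ofNat_of_zero_le (hd _ hDρ)
  have hDk : D ∈ g.level k := ⟨hDρ, hk⟩
  have hk0 : k ≠ 0 := by
    rintro rfl
    exact hD0 (hinj _ hDρ 0 (zero_mem _) (by rw [hk, map_zero]; rfl))
  have h1 := congrArg (fun F => (PowerSeries.coeff k F).coeff (toLex (g.q D))) hconst
  simp only [PowerSeries.coeff_C, if_neg hk0, HahnSeries.coeff_zero] at h1
  rw [FaceSeries.Grading.series, PowerSeries.coeff_mk, g.coeffs_apply f hDk] at h1
  exact hfD h1

end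

section

open TensorProduct nonZeroDivisors

/-! ### Normality of smooth algebras and algebraic Hartogs -/

open Algebra.TensorProduct in
attribute [local instance] Algebra.TensorProduct.rightAlgebra in
/-- An étale algebra `T` over a normal domain `R` with fraction field `K` is normal if it is a
domain. Its fraction field is `T ⊗[R] K`, a domain finite over `K`; formation of the integral
closure commutes with smooth base change, so that the integral closure of `T` in `T ⊗[R] K` is `T
⊗[R] R`. -/
theorem isIntegrallyClosed_of_etale {R T : Type*} [CommRing R] [IsDomain R] [IsIntegrallyClosed R]
    [CommRing T] [IsDomain T] [Algebra R T] [Algebra.Etale R T] : IsIntegrallyClosed T := by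
  let K := FractionRing R
  have hle : Algebra.algebraMapSubmonoid T R⁰ ≤ T⁰ := by
    rw [Algebra.algebraMapSubmonoid, Submonoid.map_le_iff_le_comap]
    intro r hr
    have h0 : r ≠ 0 := nonZeroDivisors.ne_zero hr
    have := (Module.Flat.isTorsionFree : Module.IsTorsionFree R T)
    simpa [mem_nonZeroDivisors_iff_ne_zero] using h0
  have hloc : IsLocalization (Algebra.algebraMapSubmonoid T R⁰) (T ⊗[R] K) := by
    rw [Algebra.isLocalization_iff_isPushout (A := K) R⁰]
    infer_instance
  have hdom : IsDomain (T ⊗[R] K) := IsLocalization.isDomain_of_le_nonZeroDivisors _ hle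
  have hfin : Module.Finite K (T ⊗[R] K) := by
    have := Algebra.FormallyUnramified.finite_of_free K (K ⊗[R] T)
    exact Module.Finite.equiv (Algebra.TensorProduct.commRight R K T).toLinearEquiv
  have hfield : IsField (T ⊗[R] K) :=
    isField_of_isIntegral_of_isField' (R := K) (Field.toIsField K)
  let := hfield.toField
  have hfrac : IsFractionRing T (T ⊗[R] K) := by
    refine IsLocalization.of_le (S := T ⊗[R] K) (Algebra.algebraMapSubmonoid T R⁰) T⁰ hle
      fun r hr => ?_
    rw [isUnit_iff_ne_zero]
    exact fun h => nonZeroDivisors.ne_zero hr (IsLocalization.injective (T ⊗[R] K) hle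
      (h.trans (map_zero _).symm))
  rw [isIntegrallyClosed_iff (T ⊗[R] K)]
  intro x hx
  obtain ⟨y, hy⟩ := (TensorProduct.toIntegralClosure_bijective_of_smooth (R := R) (S := T)
    (B := K)).2 ⟨x, hx⟩
  have hy' := congrArg Subtype.val hy
  simp only [TensorProduct.toIntegralClosure] at hy'
  suffices ∀ y : T ⊗[R] integralClosure R K,
      ∃ t, algebraMap T (T ⊗[R] K) t =
        Algebra.TensorProduct.map (.id T T) (integralClosure R K).val y by
    obtain ⟨t, ht⟩ := this y
    exact ⟨t, ht.trans hy'⟩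
  intro y
  induction y with
  | zero => exact ⟨0, by simp⟩
  | add a b ha hb =>
    obtain ⟨s, hs⟩ := ha
    obtain ⟨t, ht⟩ := hb
    exact ⟨s + t, by rw [map_add, map_add, hs, ht]⟩
  | tmul a b =>
    obtain ⟨r, hr⟩ := IsIntegrallyClosed.isIntegral_iff.mp b.2
    refine ⟨r • a, ?_⟩
    simp [← hr, Algebra.TensorProduct.algebraMap_apply, Algebra.algebraMap_eq_smul_one (A := K),
      TensorProduct.smul_tmul]

/-- A smooth domain over a field is normal: locally it is étale over a polynomial ring. -/
theorem isIntegrallyClosed_of_smooth (k : Type*) [Field k] {S : Type*} [CommRing S] [IsDomain S]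
    [Algebra k S] [Algebra.Smooth k S] : IsIntegrallyClosed S := by
  refine IsIntegrallyClosed.of_localization_maximal fun p _ hp => ?_
  obtain ⟨f, hf, n, _, _, _⟩ :=
    Algebra.IsSmoothAt.exists_isStandardEtale_mvPolynomial (R := k) (p := p)
  have hf0 : Submonoid.powers f ≤ p.primeCompl := by
    rw [Submonoid.powers_le]; exact hf
  have hpS : p.primeCompl ≤ S⁰ := p.primeCompl_le_nonZeroDivisors
  have : IsDomain (Localization.Away f) :=
    IsLocalization.isDomain_localization (hf0.trans hpS)
  have : IsIntegrallyClosed (Localization.Away f) :=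
    isIntegrallyClosed_of_etale (R := MvPolynomial (Fin n) k)
  let φ : Localization.Away f →+* Localization.AtPrime p :=
    IsLocalization.lift (M := Submonoid.powers f) (g := algebraMap S (Localization.AtPrime p))
      fun y => IsLocalization.map_units (Localization.AtPrime p) ⟨y.1, hf0 y.2⟩
  let := φ.toAlgebra
  have : IsScalarTower S (Localization.Away f) (Localization.AtPrime p) :=
    .of_algebraMap_eq fun x => (IsLocalization.lift_eq _ x).symm
  have := IsLocalization.isLocalization_of_submonoid_le (Localization.Away f)
    (Localization.AtPrime p) (Submonoid.powers f) p.primeCompl hf0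
  refine isIntegrallyClosed_of_isLocalization _
    (p.primeCompl.map (algebraMap S (Localization.Away f))) ?_
  rw [Submonoid.map_le_iff_le_comap]
  intro x hx
  have := (IsLocalization.injective (Localization.Away f) (hf0.trans hpS)).ne
    (nonZeroDivisors.ne_zero (hpS hx))
  simpa [mem_nonZeroDivisors_iff_ne_zero] using this

/-- A Noetherian normal domain is the intersection of its localizations at primes of height one. If
`f` is not in `A`, choose a maximal ideal of denominators of a multiple `g = c f` not in `A`. It is
a prime `p`, and normality gives `p g ⊄ p`, so that `p` is minimal over a principal ideal. -/
theorem IsIntegrallyClosed.exists_algebraMap_eq_of_forall_height_eq_one {A K : Type*} [CommRing A]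
    [IsDomain A] [IsNoetherianRing A] [IsIntegrallyClosed A] [Field K] [Algebra A K]
    [IsFractionRing A K] (f : K)
    (h : ∀ p : Ideal A, p.IsPrime → p.height = 1 →
      ∃ a, ∃ s ∉ p, f * algebraMap A K s = algebraMap A K a) :
    ∃ a, algebraMap A K a = f := by
  classical
  by_contra hf
  -- `I c` is the ideal of denominators of `c * f`.
  let I : A → Ideal A := fun c =>
    { carrier := {x | ∃ a, algebraMap A K a = algebraMap A K (x * c) * f}
      add_mem' := by
        rintro x y ⟨a, ha⟩ ⟨b, hb⟩
        exact ⟨a + b, by rw [map_add, ha, hb, add_mul x y c, map_add, add_mul]⟩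
      zero_mem' := ⟨0, by simp⟩
      smul_mem' := by
        rintro x y ⟨a, ha⟩
        exact ⟨x * a, by rw [map_mul, ha, smul_eq_mul, mul_assoc x y c, map_mul _ x, mul_assoc]⟩ }
  have hI : ∀ c x, x ∈ I c ↔ ∃ a, algebraMap A K a = algebraMap A K (x * c) * f :=
    fun _ _ => Iff.rfl
  obtain ⟨p, ⟨c, hc, rfl⟩, hmax⟩ := set_has_maximal_iff_noetherian.mpr ‹IsNoetherianRing A›
    {J | ∃ c, (¬ ∃ a, algebraMap A K a = algebraMap A K c * f) ∧ I c = J}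
    ⟨I 1, 1, by simpa using hf, rfl⟩
  have hprime : (I c).IsPrime := by
    refine Ideal.isPrime_iff.mpr ⟨fun htop => hc ?_, fun {x y} hxy => or_iff_not_imp_right.mpr
      fun hy => ?_⟩
    · simpa [hI] using (Ideal.eq_top_iff_one _).mp htop
    · have hle : I c ≤ I (y * c) := by
        rintro z ⟨a, ha⟩
        refine ⟨y * a, ?_⟩
        rw [map_mul, ha, ← mul_assoc, ← map_mul]
        congr 2; ring
      have heq : I c = I (y * c) := by
        by_contra hne
        exact hmax (I (y * c)) ⟨y * c, hy, rfl⟩ (lt_of_le_of_ne hle hne)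
      rw [heq, hI]
      rw [hI] at hxy
      rwa [← mul_assoc]
  have hne : I c ≠ ⊥ := by
    obtain ⟨a, b, hb, hab⟩ := IsFractionRing.div_surjective (A := A) f
    have hb0 : algebraMap A K b ≠ 0 := by
      simpa using nonZeroDivisors.ne_zero hb
    intro h0
    have : b ∈ I c := ⟨c * a, by rw [← hab, map_mul, map_mul]; field_simp⟩
    rw [h0] at this
    exact nonZeroDivisors.ne_zero hb this
  set g := algebraMap A K c * f with hg
  have hIg : ∀ x, x ∈ I c ↔ ∃ a, algebraMap A K a = algebraMap A K x * g := by
    intro x; rw [hI, map_mul, hg, mul_assoc]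
  -- Otherwise `g` would be integral over `A`, as it would preserve a finitely generated module.
  have hex : ∃ x ∈ I c, ∃ u ∉ I c, algebraMap A K u = algebraMap A K x * g := by
    by_contra! hcon
    have hint : IsIntegral A g := by
      refine isIntegral_of_smul_mem_submodule (M := K)
        (Submodule.map (Algebra.linearMap A K) (I c)) ?_ ?_ g ?_
      · exact fun h0 => hne (Submodule.map_injective_of_injective (IsFractionRing.injective A K)
          (h0.trans (Submodule.map_bot _).symm))
      · exact (IsNoetherian.noetherian (I c)).map _
      · rintro _ ⟨x, hx, rfl⟩
        obtain ⟨a, ha⟩ := (hIg x).mp hx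
        refine ⟨a, by_contra fun h' => hcon x hx a h' ha, ?_⟩
        rw [Algebra.linearMap_apply, Algebra.linearMap_apply, ha, smul_eq_mul, mul_comm]
    exact hc (IsIntegrallyClosed.isIntegral_iff.mp hint)
  obtain ⟨x, hx, u, hu, hxu⟩ := hex
  have hmin : I c ∈ (Ideal.span {x}).minimalPrimes := by
    refine ⟨⟨hprime, by simpa using hx⟩, fun q ⟨hq, hxq⟩ hle y hy => ?_⟩
    obtain ⟨v, hv⟩ := (hIg y).mp hy
    have : u * y = v * x := by
      apply IsFractionRing.injective A K
      rw [map_mul, map_mul, hxu, hv]; ring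
    have h1 : u * y ∈ q := this ▸ q.mul_mem_left v (by simpa using hxq)
    exact (hq.mem_or_mem h1).resolve_left fun h => hu (hle h)
  have hheight : (I c).height = 1 := by
    refine le_antisymm (Ideal.height_le_one_of_isPrincipal_of_mem_minimalPrimes _ _ hmin) ?_
    rwa [Order.one_le_iff_ne_zero, ne_eq, Ideal.height_eq_zero_iff_eq_bot]
  obtain ⟨a, s, hs, hfs⟩ := h _ hprime hheight
  exact hs ⟨c * a, by rw [map_mul, ← hfs, map_mul]; ring⟩

end

section

open Polynomial

/-! ### Finiteness of spaces of forms -/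

attribute [local instance] FractionRing.liftAlgebra in
/-- The integral closure of a domain of finite type over a field of characteristic zero in its
fraction field is finite: by Noether normalization the domain is finite over a polynomial ring,
and the extension of fraction fields is finite separable. -/
theorem finite_integralClosure_fractionRing (k : Type*) [Field k] [CharZero k] {B : Type*}
    [CommRing B] [IsDomain B] [Algebra k B] [Algebra.FiniteType k B] :
    Module.Finite B (integralClosure B (FractionRing B)) := by
  obtain ⟨d, g, hg, hfin⟩ := exists_finite_inj_algHom_of_fg k B
  let P := MvPolynomial (Fin d) k
  let F := FractionRing B
  let := g.toAlgebra
  have : FaithfulSMul P B := (faithfulSMul_iff_algebraMap_injective P B).mpr hg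
  have : Module.Finite P B := hfin
  let E := FractionRing P
  have : FiniteDimensional E F := inferInstance
  have : CharZero P := inferInstance
  have : CharZero E := charZero_of_injective_algebraMap (IsFractionRing.injective P E)
  have : IsNoetherian P (integralClosure P F) := IsIntegralClosure.isNoetherian P E F _
  let e : integralClosure B F →ₗ[P] integralClosure P F :=
    { toFun := fun x => ⟨x.1, isIntegral_trans (A := B) x.1 x.2⟩
      map_add' := fun _ _ => rfl
      map_smul' := fun _ _ => rfl }
  have : Module.Finite P (integralClosure B F) :=
    Module.Finite.of_injective e fun x y h => Subtype.ext (congrArg (fun z => z.1) h)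
  exact Module.Finite.of_restrictScalars_finite P B _

/-- With `V` the span of the `yᵢ`, the coefficient of degree `l` of an element of the graded algebra
`k[yᵢ X]` lies in `V ^ l`. -/
theorem coeff_mem_pow_of_mem_adjoin {k K : Type*} [Field k] [Field K] [Algebra k K] {ι : Type*}
    (y : ι → K) {b : K[X]} (hb : b ∈ Algebra.adjoin k (Set.range fun i => C (y i) * X)) (l : ℕ) :
    b.coeff l ∈ Submodule.span k (Set.range y) ^ l := by
  induction hb using Algebra.adjoin_induction generalizing l with
  | mem x hx =>
    obtain ⟨i, rfl⟩ := hx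
    simp only [coeff_C_mul, coeff_X]
    split_ifs with h
    · subst h; simpa using Submodule.subset_span (Set.mem_range_self i)
    · simp
  | algebraMap r =>
    rw [Polynomial.algebraMap_apply, coeff_C]
    split_ifs with h
    · subst h
      simp only [pow_zero]
      exact Submodule.algebraMap_mem r
    · simp
  | add x y _ _ hx hy => rw [coeff_add]; exact add_mem (hx l) (hy l)
  | mul x y _ _ hx hy =>
    rw [coeff_mul]
    refine sum_mem fun p hp => ?_
    rw [← Finset.HasAntidiagonal.mem_antidiagonal.mp hp, pow_add]
    exact Submodule.mul_mem_mul (hx _) (hy _)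

/-- Conversely to `coeff_mem_pow_of_mem_adjoin`, the elements of `V ^ l` are coefficients of degree
`l` of homogeneous elements of `k[yᵢ X]`. -/
theorem C_mul_X_pow_mem_adjoin {k K : Type*} [Field k] [Field K] [Algebra k K] {ι : Type*}
    (y : ι → K) (l : ℕ) {c : K} (hc : c ∈ Submodule.span k (Set.range y) ^ l) :
    C c * X ^ l ∈ Algebra.adjoin k (Set.range fun i => C (y i) * X) := by
  induction hc using Submodule.pow_induction_on_left' with
  | algebraMap r =>
    rw [pow_zero, mul_one]
    exact Subalgebra.algebraMap_mem _ r
  | add x y i _ _ hx hy => rw [C_add, add_mul]; exact add_mem hx hy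
  | mem_mul m hm i x hx ih =>
    have : C (m * x) * X ^ (i + 1) = (C m * X) * (C x * X ^ i) := by
      rw [C_mul]; ring
    rw [this]
    refine mul_mem ?_ ih
    clear this
    induction hm using Submodule.span_induction with
    | mem x h => obtain ⟨i, rfl⟩ := h; exact Algebra.subset_adjoin ⟨i, rfl⟩
    | zero => simp
    | add x y _ _ hx hy => rw [C_add, add_mul]; exact add_mem hx hy
    | smul a x _ hx =>
      rw [← Polynomial.smul_C, smul_mul_assoc]
      exact Subalgebra.smul_mem _ hx a

/-- An element of `k[yᵢ / yⱼ]` has numerators that are forms in the `yᵢ` of every large degree. -/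
theorem exists_forall_mul_pow_mem {k K : Type*} [Field k] [Field K] [Algebra k K] {ι : Type*}
    (y : ι → K) (j : ι) (hj : y j ≠ 0) {a : K}
    (ha : a ∈ Algebra.adjoin k (Set.range fun i => y i * (y j)⁻¹)) :
    ∃ N : ℕ, ∀ M ≥ N, a * y j ^ M ∈ Submodule.span k (Set.range y) ^ M := by
  have hp (M : ℕ) : y j ^ M ∈ Submodule.span k (Set.range y) ^ M :=
    Submodule.pow_mem_pow _ (Submodule.subset_span (Set.mem_range_self j)) M
  induction ha using Algebra.adjoin_induction with
  | mem x hx =>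
    obtain ⟨i, rfl⟩ := hx
    refine ⟨1, fun M hM => ?_⟩
    obtain ⟨M, rfl⟩ := Nat.exists_eq_add_of_le' hM
    have : y i * (y j)⁻¹ * y j ^ (M + 1) = y j ^ M * y i := by
      rw [pow_succ]; field_simp
    rw [this, pow_succ]
    exact Submodule.mul_mem_mul (hp M) (Submodule.subset_span (Set.mem_range_self i))
  | algebraMap r =>
    exact ⟨0, fun M _ => by rw [← Algebra.smul_def]; exact Submodule.smul_mem _ _ (hp M)⟩
  | add a b _ _ ha hb =>
    obtain ⟨N, hN⟩ := ha
    obtain ⟨N', hN'⟩ := hb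
    exact ⟨max N N', fun M hM => by
      rw [add_mul]
      exact add_mem (hN M (le_of_max_le_left hM)) (hN' M (le_of_max_le_right hM))⟩
  | mul a b _ _ ha hb =>
    obtain ⟨N, hN⟩ := ha
    obtain ⟨N', hN'⟩ := hb
    refine ⟨N + N', fun M hM => ?_⟩
    obtain ⟨M, rfl⟩ := Nat.exists_eq_add_of_le hM
    have : a * b * y j ^ (N + N' + M) = (a * y j ^ N) * (b * y j ^ (N' + M)) := by ring
    rw [this, add_assoc, pow_add]
    exact Submodule.mul_mem_mul (hN N le_rfl) (hN' _ (by omega))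

/-- The elements `s` of `K` such that `s / yⱼ ^ m` lies in `k[yᵢ / yⱼ]` for each `j` with `yⱼ ≠ 0`.
For homogeneous coordinates `yᵢ` of a projective variety these are the global sections of `𝒪(m)`.
-/
def formsOfDegree (k : Type*) {K : Type*} [Field k] [Field K] [Algebra k K] {ι : Type*}
    (y : ι → K) (m : ℕ) : Submodule k K :=
  ⨅ j : {j // y j ≠ 0}, (Subalgebra.toSubmodule
    (Algebra.adjoin k (Set.range fun i => y i * (y j)⁻¹))).comap
      (LinearMap.mulRight k ((y j)⁻¹ ^ m))

theorem mem_formsOfDegree {k K : Type*} [Field k] [Field K] [Algebra k K] {ι : Type*}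
    {y : ι → K} {m : ℕ} {s : K} : s ∈ formsOfDegree k y m ↔
      ∀ j, y j ≠ 0 → s * (y j)⁻¹ ^ m ∈ Algebra.adjoin k (Set.range fun i => y i * (y j)⁻¹) := by
  simp [formsOfDegree]

/-- For `V` the span of the `yᵢ` and `s` in `formsOfDegree k y m`, multiplication by `s` maps `V ^
N` into `V ^ (m + N)` for some `N`. -/
theorem exists_mul_pow_le_pow {k K : Type*} [Field k] [Field K] [Algebra k K] {ι : Type*}
    [Finite ι] {y : ι → K} {m : ℕ} {s : K} (hs : s ∈ formsOfDegree k y m) :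
    ∃ N : ℕ, ∀ c ∈ Submodule.span k (Set.range y) ^ N,
      s * c ∈ Submodule.span k (Set.range y) ^ (m + N) := by
  classical
  have := Fintype.ofFinite ι
  have h1 (j : ι) : ∃ N : ℕ, ∀ M ≥ N, s * y j ^ M ∈ Submodule.span k (Set.range y) ^ (m + M) := by
    by_cases hj : y j = 0
    · refine ⟨1, fun M hM => ?_⟩
      rw [hj, zero_pow (by omega), mul_zero]
      exact zero_mem _
    · obtain ⟨N, hN⟩ := exists_forall_mul_pow_mem y j hj (mem_formsOfDegree.mp hs j hj)
      refine ⟨N, fun M hM => ?_⟩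
      have := hN (m + M) (by omega)
      rw [pow_add (y j)] at this
      have hc : s * y j ^ M = s * (y j)⁻¹ ^ m * (y j ^ m * y j ^ M) := by
        rw [inv_pow]; field_simp
      rwa [hc]
  choose N hN using h1
  -- A monomial of this degree contains some `y j` with exponent at least `N j`.
  refine ⟨(∑ j, N j) + 1, fun c hc => ?_⟩
  rw [Submodule.span_pow] at hc
  induction hc using Submodule.span_induction with
  | mem x hx =>
    obtain ⟨f, rfl⟩ := Set.mem_pow.mp hx
    choose e he using fun i => (f i).2
    set c : ι → ℕ := fun j => (Finset.univ.filter fun i => e i = j).card with hcdef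
    have hsum : ∑ j, c j = (∑ j, N j) + 1 := by
      have := Finset.card_eq_sum_card_fiberwise (s := Finset.univ) (t := Finset.univ) (f := e)
        (fun i _ => Finset.mem_univ _)
      rw [Finset.card_univ, Fintype.card_fin] at this
      exact this.symm
    have hprod : (List.ofFn fun i => (f i : K)).prod = ∏ j, y j ^ c j := by
      rw [List.prod_ofFn, ← Finset.prod_fiberwise_of_maps_to (g := e) (t := Finset.univ)
        (fun i _ => Finset.mem_univ _)]
      refine Finset.prod_congr rfl fun j _ => ?_
      rw [hcdef, ← Finset.prod_const]
      refine Finset.prod_congr rfl fun i hi => ?_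
      rw [← he i, (Finset.mem_filter.mp hi).2]
    obtain ⟨j, hj⟩ : ∃ j, N j ≤ c j := by
      by_contra! hcon
      have := Finset.sum_le_sum fun j (_ : j ∈ Finset.univ) => (hcon j).le
      omega
    rw [hprod, ← Finset.mul_prod_erase _ _ (Finset.mem_univ j), ← mul_assoc, ← hsum,
      ← Finset.add_sum_erase _ _ (Finset.mem_univ j), ← add_assoc, pow_add]
    refine Submodule.mul_mem_mul (hN j _ hj) ?_
    rw [← Finset.prod_pow_eq_pow_sum]
    generalize Finset.univ.erase j = t
    induction t using Finset.induction_on with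
    | empty => simp
    | insert i t hi ih =>
      rw [Finset.prod_insert hi, Finset.prod_insert hi]
      exact Submodule.mul_mem_mul
        (Submodule.pow_mem_pow _ (Submodule.subset_span (Set.mem_range_self i)) _) ih
  | zero => simp
  | add x y _ _ hx hy => rw [mul_add]; exact add_mem hx hy
  | smul a x _ hx => rw [mul_smul_comm]; exact Submodule.smul_mem _ a hx

/-- The coefficients of fixed degree of a finitely generated module over the graded algebra
`k[yᵢ X]` lie in a finite-dimensional space. -/
theorem exists_fg_forall_coeff_mem {k K : Type*} [Field k] [Field K] [Algebra k K] {ι : Type*}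
    [Finite ι] (y : ι → K)
    {N : Submodule (Algebra.adjoin k (Set.range fun i => C (y i) * X)) K[X]} (hN : N.FG) (m : ℕ) :
    ∃ D : Submodule k K, D.FG ∧ ∀ g ∈ N, g.coeff m ∈ D := by
  classical
  obtain ⟨t, ht⟩ := hN
  let P : Submodule k K := ⨆ l ∈ Finset.range (m + 1), Submodule.span k (Set.range y) ^ l
  let Q : Submodule k K := Submodule.span k
    (t.biUnion fun g => (Finset.range (m + 1)).image fun l => g.coeff l : Finset K)
  refine ⟨P * Q, .mul (Submodule.fg_biSup _ _ fun l _ =>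
    (Submodule.fg_span (Set.finite_range y)).pow l) (Submodule.fg_span (Finset.finite_toSet _)),
    fun g hg => ?_⟩
  rw [← ht] at hg
  obtain ⟨c, -, rfl⟩ := Submodule.mem_span_finset.mp hg
  rw [finsetSum_coeff]
  refine sum_mem fun h hh => ?_
  rw [Subalgebra.smul_def, smul_eq_mul, coeff_mul]
  refine sum_mem fun p hp => ?_
  have hp := Finset.HasAntidiagonal.mem_antidiagonal.mp hp
  refine Submodule.mul_mem_mul ?_ (Submodule.subset_span ?_)
  · exact le_biSup (fun l => Submodule.span k (Set.range y) ^ l)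
      (Finset.mem_range.mpr (by omega : p.1 < m + 1))
      (coeff_mem_pow_of_mem_adjoin y (c h).2 p.1)
  · rw [Finset.mem_coe, Finset.mem_biUnion]
    exact ⟨h, hh, Finset.mem_image.mpr ⟨p.2, Finset.mem_range.mpr (by omega), rfl⟩⟩

/-- If `s V ^ n ⊆ V ^ (m + n)`, then `s X ^ m` is integral over `k[yᵢ X]`, since it preserves the
module generated by `V ^ n X ^ n`. -/
theorem isIntegral_C_mul_X_pow {k K : Type*} [Field k] [Field K] [Algebra k K] {ι : Type*}
    [Finite ι] {y : ι → K} {j : ι} (hj : y j ≠ 0) {s : K} {m n : ℕ}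
    (hn : ∀ c ∈ Submodule.span k (Set.range y) ^ n,
      s * c ∈ Submodule.span k (Set.range y) ^ (m + n)) :
    IsIntegral (Algebra.adjoin k (Set.range fun i => C (y i) * X)) (C s * X ^ m : K[X]) := by
  obtain ⟨S, hS⟩ := (Submodule.fg_span (R := k) (Set.finite_range y)).pow n
  have hmon : ∀ c ∈ Submodule.span k (Set.range y) ^ n, (C c * X ^ n : K[X]) ∈
      Submodule.span (Algebra.adjoin k (Set.range fun i => C (y i) * X))
        ((fun c : K => (C c * X ^ n : K[X])) '' S) := by
    intro c hc
    rw [← hS] at hc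
    induction hc using Submodule.span_induction with
    | mem c hc => exact Submodule.subset_span ⟨c, hc, rfl⟩
    | zero => simp
    | add u v _ _ hu hv => rw [C_add, add_mul]; exact add_mem hu hv
    | smul a u _ hu =>
      rw [← Polynomial.smul_C, smul_mul_assoc, ← algebraMap_smul
        (Algebra.adjoin k (Set.range fun i => C (y i) * X)) a (C u * X ^ n)]
      exact Submodule.smul_mem _ _ hu
  refine isIntegral_of_smul_mem_submodule (M := K[X])
    (Submodule.span (Algebra.adjoin k (Set.range fun i => C (y i) * X))
      ((fun c : K => (C c * X ^ n : K[X])) '' S)) ?_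
    (Submodule.fg_span (S.finite_toSet.image _)) _ fun g hg => ?_
  · intro h0
    have h1 := hmon _ (Submodule.pow_mem_pow _
      (Submodule.subset_span (Set.mem_range_self j)) n)
    rw [h0, Submodule.mem_bot] at h1
    have := congrArg (fun q : K[X] => q.coeff n) h1
    simp only [coeff_C_mul, coeff_X_pow_self, mul_one, coeff_zero] at this
    exact pow_ne_zero n hj this
  · induction hg using Submodule.span_induction with
    | mem g hg =>
      obtain ⟨c, hc, rfl⟩ := hg
      have hcY : c ∈ Submodule.span k (Set.range y) ^ n := hS ▸ Submodule.subset_span hc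
      have h1 := hn c hcY
      have h2 : (C s * X ^ m : K[X]) • ((C c * X ^ n : K[X])) = C (s * c) * X ^ (m + n) := by
        rw [smul_eq_mul, C_mul]; ring
      change (C s * X ^ m : K[X]) • ((C c * X ^ n : K[X])) ∈ _
      rw [h2]
      rw [pow_add] at h1
      clear h2
      generalize s * c = d at h1 ⊢
      induction h1 using Submodule.mul_induction_on' with
      | mem_mul_mem u hu v hv =>
        have h3 : (C (u * v) * X ^ (m + n) : K[X]) =
            (⟨C u * X ^ m, C_mul_X_pow_mem_adjoin y _ hu⟩ :
              Algebra.adjoin k (Set.range fun i => C (y i) * X)) • (C v * X ^ n : K[X]) := by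
          rw [Subalgebra.smul_def, smul_eq_mul, C_mul]; ring
        rw [h3]
        exact Submodule.smul_mem _ _ (hmon v hv)
      | add u _ v _ hu hv => rw [C_add, add_mul]; exact add_mem hu hv
    | zero => rw [smul_zero]; exact zero_mem _
    | add u v _ _ hu hv => rw [smul_add]; exact add_mem hu hv
    | smul b u _ hu => rw [smul_comm]; exact Submodule.smul_mem _ _ hu

attribute [local instance] FractionRing.liftAlgebra in
/-- Suppose that the integral closure of `B` in its fraction field is finite. Then the elements of
an extension `A` that are integral over `B` and are fractions of elements of `B` lie in a finitely
generated `B`-module. -/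
theorem exists_fg_forall_isIntegral_mem {B A : Type*} [CommRing B] [IsDomain B]
    [IsNoetherianRing B] [CommRing A] [IsDomain A] [Algebra B A] [FaithfulSMul B A]
    (hfin : Module.Finite B (integralClosure B (FractionRing B))) :
    ∃ N : Submodule B A, N.FG ∧ ∀ g : A, IsIntegral B g →
      ∀ b b' : B, b' ≠ 0 → g * algebraMap B A b' = algebraMap B A b → g ∈ N := by
  let F := FractionRing B
  let L := FractionRing A
  have hAL := IsFractionRing.injective A L
  have : FaithfulSMul B L := (faithfulSMul_iff_algebraMap_injective B L).mpr <| by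
    rw [IsScalarTower.algebraMap_eq B A L]
    exact hAL.comp (FaithfulSMul.algebraMap_injective B A)
  have : IsScalarTower B F L := FractionRing.isScalarTower_liftAlgebra B L
  let W : Submodule B L := (Subalgebra.toSubmodule (integralClosure B F)).map
    (IsScalarTower.toAlgHom B F L).toLinearMap
  have hWfg : W.FG := (Module.Finite.iff_fg.mp hfin).map _
  let N : Submodule B A := W.comap (IsScalarTower.toAlgHom B A L).toLinearMap
  have : Module.Finite B W := Module.Finite.iff_fg.mpr hWfg
  have : IsNoetherian B W := isNoetherian_of_isNoetherianRing_of_finite B W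
  refine ⟨N, Module.Finite.iff_fg.mp (Module.Finite.of_injective
    ((IsScalarTower.toAlgHom B A L).toLinearMap.restrict (p := N) (q := W) fun x hx => hx)
    fun x y hxy => Subtype.ext (hAL (congrArg Subtype.val hxy))), fun g hg b b' hb' hgb => ?_⟩
  let w : F := algebraMap B F b / algebraMap B F b'
  have hw : algebraMap F L w = algebraMap A L g := by
    have h0 : algebraMap A L (algebraMap B A b') ≠ 0 := by
      rw [ne_eq, map_eq_zero_iff _ hAL, map_eq_zero_iff _ (FaithfulSMul.algebraMap_injective B A)]
      exact hb'
    rw [map_div₀, ← IsScalarTower.algebraMap_apply, ← IsScalarTower.algebraMap_apply,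
      IsScalarTower.algebraMap_apply B A L b, IsScalarTower.algebraMap_apply B A L b',
      div_eq_iff h0, ← map_mul, hgb]
  refine ⟨w, (isIntegral_algebraMap_iff (algebraMap F L).injective).mp ?_, hw⟩
  rw [hw]
  exact hg.algebraMap

/-- The space of forms of degree `m` is finite-dimensional: for such a form `s`, the monomial `s X
^ m` belongs to the integral closure of `k[yᵢ X]` in its fraction field, a finite module over `k[yᵢ
X]`. -/
theorem finite_formsOfDegree {k K : Type*} [Field k] [CharZero k] [Field K] [Algebra k K]
    {ι : Type*} [Finite ι] {y : ι → K} (hy : ∃ j, y j ≠ 0) (m : ℕ) :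
    Module.Finite k (formsOfDegree k y m) := by
  obtain ⟨j, hj⟩ := hy
  let B := Algebra.adjoin k (Set.range fun i => C (y i) * X)
  have hBft : Algebra.FiniteType k B := (Subalgebra.fg_iff_finiteType _).mp
    ⟨(Set.finite_range fun i => C (y i) * X).toFinset, by rw [Set.Finite.coe_toFinset]⟩
  have hBN : IsNoetherianRing B := Algebra.FiniteType.isNoetherianRing k B
  obtain ⟨N, hNfg, hN⟩ := exists_fg_forall_isIntegral_mem (A := K[X])
    (finite_integralClosure_fractionRing k (B := B))
  have hmem : ∀ s ∈ formsOfDegree k y m, C s * X ^ m ∈ N := by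
    intro s hs
    obtain ⟨n, hn⟩ := exists_mul_pow_le_pow hs
    have hyn : y j ^ n ∈ Submodule.span k (Set.range y) ^ n :=
      Submodule.pow_mem_pow _ (Submodule.subset_span (Set.mem_range_self j)) n
    refine hN _ (isIntegral_C_mul_X_pow hj hn)
      ⟨C (s * y j ^ n) * X ^ (m + n), C_mul_X_pow_mem_adjoin y _ (hn _ hyn)⟩
      ⟨C (y j ^ n) * X ^ n, C_mul_X_pow_mem_adjoin y _ hyn⟩ (fun h => ?_) ?_
    · have := congrArg (fun q : B => q.1.coeff n) h
      simp only [coeff_C_mul, coeff_X_pow_self, mul_one, ZeroMemClass.coe_zero,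
        coeff_zero] at this
      exact pow_ne_zero n hj this
    · change C s * X ^ m * (C (y j ^ n) * X ^ n) = C (s * y j ^ n) * X ^ (m + n)
      rw [C_mul]; ring
  obtain ⟨D, hD, hND⟩ := exists_fg_forall_coeff_mem y hNfg m
  have : Module.Finite k D := Module.Finite.iff_fg.mpr hD
  refine Submodule.finiteDimensional_of_le (S₂ := D) fun s hs => ?_
  simpa using hND _ (hmem s hs)

end

namespace SmoothProjectiveVariety

/-! ### Local rings and orders of vanishing -/

variable (X : SmoothProjectiveVariety)

/-- The structure map `ℂ → Γ(X, U)`. -/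
noncomputable def scalars (U : X.scheme.Opens) : ℂ →+* Γ(X.scheme, U) :=
  (X.str.appLE ⊤ U le_top).hom.comp (Scheme.ΓSpecIso (CommRingCat.of ℂ)).inv.hom

variable {X}

theorem germToFunctionField_scalars (U : X.scheme.Opens) [Nonempty U] (c : ℂ) :
    X.scheme.germToFunctionField U (X.scalars U c) = algebraMap ℂ X.RatFunc c := by
  have h : X.str.appLE ⊤ U le_top ≫ X.scheme.germToFunctionField U =
      X.str.appTop ≫ X.scheme.presheaf.germ ⊤ (genericPoint X.scheme) trivial := by
    have h1 : X.str.appTop ≫ X.scheme.presheaf.map (homOfLE le_top).op =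
        X.str.appLE ⊤ U le_top := rfl
    rw [← h1, Category.assoc]
    congr 1
    exact X.scheme.presheaf.germ_res _ _ _
  exact congrArg (fun φ => φ.hom ((Scheme.ΓSpecIso (CommRingCat.of ℂ)).inv.hom c)) h

theorem smooth_scalars {U : X.scheme.Opens} (hU : IsAffineOpen U) :
    (X.scalars U).Smooth := by
  have h := HasRingHomProperty.appLE @Smooth X.str X.smooth
    ⟨⊤, isAffineOpen_top (Spec (CommRingCat.of ℂ))⟩ ⟨U, hU⟩ le_top
  have h2 := RingHom.Smooth.respectsIso.2 (X.str.appLE ⊤ U le_top).hom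
    (Scheme.ΓSpecIso (CommRingCat.of ℂ)).symm.commRingCatIsoToRingEquiv h
  exact h2

theorem isNoetherianRing_of_isAffineOpen {U : X.scheme.Opens} (hU : IsAffineOpen U) :
    IsNoetherianRing Γ(X.scheme, U) :=
  IsLocallyNoetherian.component_noetherian ⟨U, hU⟩

theorem isIntegrallyClosed_of_isAffineOpen {U : X.scheme.Opens} (hU : IsAffineOpen U)
    [Nonempty U] : IsIntegrallyClosed Γ(X.scheme, U) := by
  let := (X.scalars U).toAlgebra
  have : Algebra.Smooth ℂ Γ(X.scheme, U) := X.smooth_scalars hU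
  exact isIntegrallyClosed_of_smooth ℂ

instance isIntegrallyClosed_stalk (x : X.scheme) :
    IsIntegrallyClosed (X.scheme.presheaf.stalk x) := by
  obtain ⟨_, ⟨U, hU, rfl⟩, hxU, -⟩ :=
    X.scheme.isBasis_affineOpens.exists_subset_of_mem_open (Set.mem_univ x) isOpen_univ
  have hU : IsAffineOpen U := hU
  have : Nonempty U := ⟨⟨x, hxU⟩⟩
  have := isIntegrallyClosed_of_isAffineOpen hU
  let := TopCat.Presheaf.algebra_section_stalk X.scheme.presheaf ⟨x, hxU⟩
  have := hU.isLocalization_stalk ⟨x, hxU⟩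
  exact isIntegrallyClosed_of_isLocalization (X.scheme.presheaf.stalk x)
    (hU.primeIdealOf ⟨x, hxU⟩).asIdeal.primeCompl
    (Ideal.primeCompl_le_nonZeroDivisors _)

theorem isDiscreteValuationRing_stalk {x : X.scheme} (hx : Order.coheight x = 1) :
    IsDiscreteValuationRing (X.scheme.presheaf.stalk x) := by
  have hdim := ringKrullDim_stalk_eq_coheight x
  rw [hx] at hdim
  have hnf : ¬ IsField (X.scheme.presheaf.stalk x) := fun h => by
    rw [ringKrullDim_eq_zero_of_isField h] at hdim
    exact absurd hdim (by norm_num)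
  have : Ring.KrullDimLE 1 (X.scheme.presheaf.stalk x) := krullDimLE_of_coheight_le hx.le
  have : Ring.DimensionLEOne (X.scheme.presheaf.stalk x) :=
    ⟨fun hp hpp => hpp.isMaximal_of_ne_bot hp⟩
  have : IsDedekindRing (X.scheme.presheaf.stalk x) := {}
  have : IsDedekindDomain (X.scheme.presheaf.stalk x) := {}
  exact ((IsDiscreteValuationRing.TFAE _ hnf).out 0 2).mpr this

instance (z : X.PrimeDivisor) : IsDiscreteValuationRing (X.scheme.presheaf.stalk z.1) :=
  isDiscreteValuationRing_stalk z.2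

theorem ordAlong_eq_zero_of_isUnit {z : X.PrimeDivisor} {a : X.scheme.presheaf.stalk z.1}
    (ha : IsUnit a) : X.ordAlong (algebraMap _ X.RatFunc a) z = 0 := by
  have : Ring.KrullDimLE 1 (X.scheme.presheaf.stalk z.1) := krullDimLE_of_coheight_le z.2.le
  have h := Ring.ordFrac_of_isUnit (K := X.RatFunc) ha
  rw [ordAlong, Scheme.ord_eq_iff z.2]
  · exact h
  · exact (ha.map (algebraMap _ X.RatFunc)).ne_zero

theorem ordAlong_nonneg_iff {z : X.PrimeDivisor} {f : X.RatFunc} :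
    0 ≤ X.ordAlong f z ↔ ∃ a, algebraMap (X.scheme.presheaf.stalk z.1) X.RatFunc a = f := by
  have : Ring.KrullDimLE 1 (X.scheme.presheaf.stalk z.1) := krullDimLE_of_coheight_le z.2.le
  have key : ∀ a : X.scheme.presheaf.stalk z.1, a ≠ 0 →
      0 ≤ X.ordAlong (algebraMap _ X.RatFunc a) z := fun a ha => by
    rw [ordAlong, Scheme.le_ord_iff z.2]
    · exact Ring.ordFrac_ge_one_of_ne_zero ha
    · exact (map_ne_zero_iff _ (IsFractionRing.injective _ X.RatFunc)).mpr ha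
  constructor
  · intro h
    rcases eq_or_ne f 0 with rfl | hf
    · exact ⟨0, map_zero _⟩
    rcases ValuationRing.isInteger_or_isInteger (X.scheme.presheaf.stalk z.1) f with hi | ⟨b, hb⟩
    · exact hi
    have hb0 : b ≠ 0 := by
      rintro rfl
      rw [map_zero] at hb
      exact inv_ne_zero hf hb.symm
    have h1 := key b hb0
    rw [hb, X.ordAlong_inv hf] at h1
    have h0 : X.ordAlong f z = 0 := by omega
    have h2 : IsUnit b := by
      rw [Ring.isUnit_iff_ordFrac_one_of_isDiscreteValuationRing (K := X.RatFunc), hb]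
      rw [← neg_eq_zero, ← X.ordAlong_inv hf] at h0
      exact (Scheme.ord_eq_iff z.2 (inv_ne_zero hf)).mp h0
    obtain ⟨c, hc⟩ := h2.exists_right_inv
    refine ⟨c, ?_⟩
    have := congrArg (algebraMap _ X.RatFunc) hc
    rw [map_mul, hb, map_one] at this
    field_simp at this
    exact this
  · rintro ⟨a, rfl⟩
    rcases eq_or_ne a 0 with rfl | ha
    · rw [map_zero, ordAlong, Scheme.ord_zero]; rfl
    · exact key a ha

theorem ordAlong_algebraMap {c : ℂ} (hc : c ≠ 0) (z : X.PrimeDivisor) :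
    X.ordAlong (algebraMap ℂ X.RatFunc c) z = 0 := by
  have : Nonempty (⊤ : X.scheme.Opens) := ⟨⟨z.1, trivial⟩⟩
  rw [← germToFunctionField_scalars ⊤ c]
  exact Scheme.ord_of_isUnit ((isUnit_iff_ne_zero.mpr hc).map _) trivial

/-- The set of functions spanning `H⁰(X, 𝒪_X(D))` is already a linear subspace. -/
theorem mem_sections_iff {D : X.Divisor} {f : X.RatFunc} :
    f ∈ X.sections D ↔ f ≠ 0 → ∀ z, 0 ≤ X.ordAlong f z + D z := by
  refine ⟨fun h => ?_, fun h => Submodule.subset_span h⟩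
  induction h using Submodule.span_induction with
  | mem x hx => exact hx
  | zero => exact fun h => (h rfl).elim
  | add f g _ _ hf hg =>
    intro h z
    rcases eq_or_ne f 0 with rfl | hf0
    · rw [zero_add] at h ⊢; exact hg h z
    rcases eq_or_ne g 0 with rfl | hg0
    · rw [add_zero] at h ⊢; exact hf h z
    have h1 := hf hf0 z
    have h2 := hg hg0 z
    have h3 := Scheme.ord_add (x := z.1) h
    rcases min_le_iff.mp h3 with h4 | h4
    · exact h1.trans (by simpa using h4)
    · exact h2.trans (by simpa using h4)
  | smul c f _ hf =>
    intro h z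
    have hc : c ≠ 0 := left_ne_zero_of_smul h
    have hf0 : f ≠ 0 := right_ne_zero_of_smul h
    have hc' : algebraMap ℂ X.RatFunc c ≠ 0 := (map_ne_zero _).mpr hc
    rw [Algebra.smul_def, X.ordAlong_mul hc' hf0]
    rw [ordAlong_algebraMap hc, zero_add]
    exact hf hf0 z

/-- A rational function without poles along the prime divisors meeting an affine open set is regular
on that set. -/
theorem exists_germToFunctionField_eq {U : X.scheme.Opens} (hU : IsAffineOpen U) [Nonempty U]
    {f : X.RatFunc} (hf : ∀ z : X.PrimeDivisor, z.1 ∈ U → 0 ≤ X.ordAlong f z) :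
    ∃ a, X.scheme.germToFunctionField U a = f := by
  have := isIntegrallyClosed_of_isAffineOpen hU
  have := isNoetherianRing_of_isAffineOpen hU
  have := functionField_isFractionRing_of_isAffineOpen X.scheme U hU
  refine IsIntegrallyClosed.exists_algebraMap_eq_of_forall_height_eq_one f fun p hp hp1 => ?_
  set x := hU.fromSpec ⟨p, hp⟩ with hx
  have hxU : x ∈ U := (hU.isoSpec.inv ⟨p, hp⟩).2
  have hx1 : Order.coheight x = 1 := by
    rw [hx]
    erw [coheight_eq_of_isOpenImmersion hU.fromSpec, ← idealHeight_eq_coheight]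
    exact hp1
  let := TopCat.Presheaf.algebra_section_stalk X.scheme.presheaf ⟨x, hxU⟩
  have := hU.isLocalization_stalk' ⟨p, hp⟩ hxU
  obtain ⟨a, ha⟩ := ordAlong_nonneg_iff.mp (hf ⟨x, hx1⟩ hxU)
  obtain ⟨⟨b, s⟩, hbs⟩ := this.surj p.primeCompl a
  refine ⟨b, s, s.2, ?_⟩
  have := congrArg (algebraMap _ X.RatFunc) hbs
  rw [map_mul, ha] at this
  have key : ∀ t : Γ(X.scheme, U), algebraMap (X.scheme.presheaf.stalk x) X.RatFunc
      (algebraMap Γ(X.scheme, U) _ t) = algebraMap Γ(X.scheme, U) X.RatFunc t := fun t =>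
    Scheme.algebraMap_germ_eq_germToFunctionField X.scheme hxU t
  rw [← key, ← key]
  exact this

end SmoothProjectiveVariety

/-! ### Homogeneous coordinates -/

namespace MvPolynomial

theorem IsHomogeneous.eval₂_mul_right {σ R S : Type*} [CommSemiring R] [CommSemiring S]
    {p : MvPolynomial σ R} {N : ℕ} (hp : p.IsHomogeneous N) (φ : R →+* S) (t : σ → S) (v : S) :
    p.eval₂ φ (fun i => t i * v) = p.eval₂ φ t * v ^ N := by
  rw [eval₂_eq, eval₂_eq, Finset.sum_mul]
  refine Finset.sum_congr rfl fun d hd => ?_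
  simp_rw [mul_pow]
  rw [Finset.prod_mul_distrib, Finset.prod_pow_eq_pow_sum, mul_assoc]
  have : ∑ i ∈ d.support, d i = N := (hp.degree_eq_sum_deg_support hd).symm
  rw [this]

end MvPolynomial

namespace SmoothProjectiveVariety

open HomogeneousLocalization

variable {n : ℕ}

theorem X_mem_projGrading (i : Fin (n + 1)) :
    (MvPolynomial.X i : MvPolynomial (Fin (n + 1)) ℂ) ∈ projGrading n 1 :=
  MvPolynomial.isHomogeneous_X ℂ i

/-- The fraction `Xᵢ / Xⱼ` in a homogeneous localization of `ℂ[X₀, …, Xₙ]`. -/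
noncomputable def coordRatio {S : Submonoid (MvPolynomial (Fin (n + 1)) ℂ)} (i : Fin (n + 1))
    {j : Fin (n + 1)} (hj : MvPolynomial.X j ∈ S) : HomogeneousLocalization (projGrading n) S :=
  HomogeneousLocalization.mk ⟨1, ⟨_, X_mem_projGrading i⟩, ⟨_, X_mem_projGrading j⟩, hj⟩

/-- The map from `ℂ` to a homogeneous localization of `ℂ[X₀, …, Xₙ]`. -/
noncomputable def scalarHom (S : Submonoid (MvPolynomial (Fin (n + 1)) ℂ)) :
    ℂ →+* HomogeneousLocalization (projGrading n) S :=
  (fromZeroRingHom (projGrading n) S).comp (algebraMap ℂ (projGrading n 0))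

/-- Dehomogenization: `p / Xⱼ ^ N` is the value of the form `p` of degree `N` at the fractions
`Xᵢ / Xⱼ`. -/
theorem mk_eq_eval₂_coordRatio {S : Submonoid (MvPolynomial (Fin (n + 1)) ℂ)} {j : Fin (n + 1)}
    (hj : MvPolynomial.X j ∈ S) {N : ℕ} {p s : MvPolynomial (Fin (n + 1)) ℂ}
    (hp : p ∈ projGrading n N) (hs : s ∈ projGrading n N) (hsS : s ∈ S)
    (h : s = MvPolynomial.X j ^ N) :
    HomogeneousLocalization.mk ⟨N, ⟨p, hp⟩, ⟨s, hs⟩, hsS⟩ =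
      p.eval₂ (scalarHom S) (fun i => coordRatio i hj) := by
  subst h
  apply val_injective
  rw [val_mk, ← HomogeneousLocalization.algebraMap_apply, MvPolynomial.hom_eval₂]
  have h1 : (fun i : Fin (n + 1) => algebraMap (HomogeneousLocalization (projGrading n) S)
      (Localization S) (coordRatio i hj)) = fun i =>
      algebraMap (MvPolynomial (Fin (n + 1)) ℂ) (Localization S) (MvPolynomial.X i) *
        Localization.mk 1 ⟨MvPolynomial.X j, hj⟩ := by
    funext i
    rw [HomogeneousLocalization.algebraMap_apply, coordRatio, val_mk,
      ← Localization.mk_one_eq_algebraMap, Localization.mk_mul, mul_one, one_mul]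
  have h2 : (algebraMap (HomogeneousLocalization (projGrading n) S) (Localization S)).comp
      (scalarHom S) =
        (algebraMap (MvPolynomial (Fin (n + 1)) ℂ) (Localization S)).comp MvPolynomial.C := by
    ext c
    rw [RingHom.comp_apply, HomogeneousLocalization.algebraMap_apply]
    rfl
  have hp' : p.IsHomogeneous N := hp
  rw [h1, hp'.eval₂_mul_right, h2]
  have h3 : p.eval₂
      ((algebraMap (MvPolynomial (Fin (n + 1)) ℂ) (Localization S)).comp MvPolynomial.C)
      (fun i => algebraMap (MvPolynomial (Fin (n + 1)) ℂ) (Localization S) (MvPolynomial.X i)) =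
        algebraMap _ _ p := by
    have := MvPolynomial.hom_eval₂ p MvPolynomial.C (algebraMap (MvPolynomial (Fin (n + 1)) ℂ)
      (Localization S)) MvPolynomial.X
    rw [MvPolynomial.eval₂_eta] at this
    exact this.symm
  rw [h3, ← Localization.mk_one_eq_algebraMap, Localization.mk_pow, Localization.mk_mul, one_pow,
    mul_one, one_mul]
  rfl

theorem coordRatio_mul {S : Submonoid (MvPolynomial (Fin (n + 1)) ℂ)} (i : Fin (n + 1))
    {j k : Fin (n + 1)} (hj : MvPolynomial.X j ∈ S) (hk : MvPolynomial.X k ∈ S) :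
    coordRatio i hj * coordRatio j hk = coordRatio i hk := by
  apply val_injective
  rw [val_mul]
  simp only [coordRatio, val_mk]
  rw [Localization.mk_mul, Localization.mk_eq_mk_iff, Localization.r_iff_exists]
  refine ⟨1, ?_⟩
  simp only [Submonoid.coe_mul, OneMemClass.coe_one]
  ring

variable (X : SmoothProjectiveVariety)

/-- Homogeneous coordinates on `X` up to a common factor: rational functions `y₀, …, yₙ` and an
affine open cover `U₀, …, Uₙ`, the nonempty members of which have the coordinate rings `ℂ[yᵢ /
yⱼ]`. A coordinate vanishing identically on `X` corresponds to an empty `Uⱼ`. -/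
structure ProjectiveCoordinates where
  /-- The dimension of the projective space. -/
  n : ℕ
  /-- The coordinates, divided by one that does not vanish on `X`. -/
  y : Fin (n + 1) → X.RatFunc
  /-- The open sets on which the coordinates do not vanish. -/
  U : Fin (n + 1) → X.scheme.Opens
  exists_mem : ∀ x, ∃ j, x ∈ U j
  isAffineOpen : ∀ j, IsAffineOpen (U j)
  ne_zero_iff : ∀ j, y j ≠ 0 ↔ Nonempty (U j)
  range_eq : ∀ j [Nonempty (U j)], Set.range (X.scheme.germToFunctionField (U j)) =
    (Algebra.adjoin ℂ (Set.range fun i => y i * (y j)⁻¹) : Set X.RatFunc)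

theorem iSup_basicOpen_X_eq_top :
    ⨆ j, Proj.basicOpen (projGrading n) (MvPolynomial.X j) = ⊤ := by
  refine Proj.iSup_basicOpen_eq_top' (projGrading n) MvPolynomial.X
    (fun i => ⟨1, X_mem_projGrading i⟩) (eq_top_iff.mpr fun p _ => ?_)
  induction p using MvPolynomial.induction_on with
  | C a => exact Subalgebra.algebraMap_mem _ (algebraMap ℂ (projGrading n 0) a)
  | add p q hp hq => exact add_mem (hp trivial) (hq trivial)
  | mul_X p i hp => exact mul_mem (hp trivial) (Algebra.subset_adjoin ⟨i, rfl⟩)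

/-- The map `Γ(Spec S₀) ⟶ Γ(Proj S, D₊(f))` given by `Proj S ⟶ Spec S₀` is the inclusion of degree
zero elements into `S_(f)`, for `S` the polynomial ring. -/
theorem toSpecZero_appTop {f : MvPolynomial (Fin (n + 1)) ℂ} {m : ℕ} (hf : f ∈ projGrading n m)
    (hm : 0 < m) :
    (Scheme.ΓSpecIso (CommRingCat.of (projGrading n 0))).inv ≫
      (Proj.toSpecZero (projGrading n)).appTop ≫
        (complexProjectiveSpace n).presheaf.map (homOfLE le_top).op =
      CommRingCat.ofHom (fromZeroRingHom (projGrading n) (Submonoid.powers f)) ≫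
        Proj.awayToSection (projGrading n) f := by
  have h := Proj.awayι_toSpecZero (projGrading n) f hf hm
  rw [← Proj.basicOpenIsoSpec_inv_ι, Category.assoc, Iso.inv_comp_eq,
    Proj.basicOpenIsoSpec_hom] at h
  have h2 := congrArg Scheme.Hom.appTop h
  rw [Scheme.Hom.comp_appTop, Scheme.Hom.comp_appTop] at h2
  have h3 : (Proj.basicOpenToSpec (projGrading n) f).appTop = _ :=
    Proj.basicOpenToSpec_app_top (projGrading n) f
  have h4 : (Proj.basicOpen (projGrading n) f).ι.appTop ≫
      (Proj.basicOpen (projGrading n) f).topIso.hom =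
        (complexProjectiveSpace n).presheaf.map (homOfLE le_top).op := by
    rfl
  rw [← h4, reassoc_of% h2]
  rw [h3, Category.assoc, Category.assoc, Iso.inv_hom_id, Category.comp_id,
    ← Scheme.ΓSpecIso_inv_naturality_assoc, Iso.inv_hom_id_assoc]

/-- A morphism `i` from `X` to projective space induces a local homomorphism `Ψ` over `ℂ` from the
local ring at the image `ξ` of the generic point to the field of rational functions; on each
`D₊(f)` containing `ξ` it describes the pull-back of functions along `i`. -/
theorem exists_local_hom (i : X.scheme ⟶ complexProjectiveSpace n)
    (hi : i ≫ complexProjectiveSpaceStr n = X.str) :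
    ∃ (ξ : ProjectiveSpectrum (projGrading n)) (Ψ : HomogeneousLocalization.AtPrime (projGrading n)
      ξ.asHomogeneousIdeal.toIdeal →+* X.RatFunc)
      (hξ : ∀ f, genericPoint X.scheme ∈ i ⁻¹ᵁ Proj.basicOpen _ f ↔
        f ∈ ξ.asHomogeneousIdeal.toIdeal.primeCompl),
      (∀ a, IsUnit (Ψ a) → IsUnit a) ∧
      (∀ c, Ψ (scalarHom _ c) = algebraMap ℂ X.RatFunc c) ∧
      ∀ (f : MvPolynomial (Fin (n + 1)) ℂ) (hf : genericPoint X.scheme ∈ i ⁻¹ᵁ Proj.basicOpen _ f)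
        (a : HomogeneousLocalization.Away (projGrading n) f),
        X.scheme.presheaf.germ (i ⁻¹ᵁ Proj.basicOpen _ f) (genericPoint X.scheme) hf
          (i.app _ (Proj.awayToSection (projGrading n) f a)) =
        Ψ (HomogeneousLocalization.mapId (projGrading n)
          (Submonoid.powers_le.mpr ((hξ f).mp hf)) a) := by
  let ξ : ProjectiveSpectrum (projGrading n) := i (genericPoint X.scheme)
  let Ψ : CommRingCat.of (HomogeneousLocalization.AtPrime (projGrading n)
      ξ.asHomogeneousIdeal.toIdeal) ⟶ X.scheme.functionField :=
    (Proj.stalkIso (projGrading n) (i (genericPoint X.scheme))).inv ≫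
      i.stalkMap (genericPoint X.scheme)
  have hξ : ∀ f, genericPoint X.scheme ∈ i ⁻¹ᵁ Proj.basicOpen _ f ↔
        f ∈ ξ.asHomogeneousIdeal.toIdeal.primeCompl := fun f => Iff.rfl
  have h1 : ∀ (f : MvPolynomial (Fin (n + 1)) ℂ)
      (hf : genericPoint X.scheme ∈ i ⁻¹ᵁ Proj.basicOpen _ f),
      Proj.awayToSection (projGrading n) f ≫ i.app _ ≫
        X.scheme.presheaf.germ (i ⁻¹ᵁ Proj.basicOpen _ f) (genericPoint X.scheme) hf =
        CommRingCat.ofHom (HomogeneousLocalization.mapId (projGrading n)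
          (Submonoid.powers_le.mpr ((hξ f).mp hf))) ≫ Ψ := by
    intro f hf
    have h2 := ProjectiveSpectrum.Proj.awayToSection_germ (projGrading n) f ξ hf
    have h3 := i.germ_stalkMap (Proj.basicOpen (projGrading n) f) (genericPoint X.scheme) hf
    rw [← h3]
    exact congrArg (fun u => u ≫ i.stalkMap (genericPoint X.scheme)) h2
  refine ⟨ξ, Ψ.hom, hξ, ?_, ?_, fun f hf a => congrArg (fun φ => φ.hom a) (h1 f hf)⟩
  · intro a ha
    have h2 : IsUnit ((Proj.stalkIso (projGrading n) (i (genericPoint X.scheme))).inv.hom a) :=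
      isUnit_of_map_unit (i.stalkMap (genericPoint X.scheme)).hom _ ha
    exact (MulEquiv.isUnit_map (Proj.stalkIso (projGrading n)
      (i (genericPoint X.scheme))).symm.commRingCatIsoToRingEquiv).mp h2
  · intro c
    obtain ⟨j, hj⟩ : ∃ j, (MvPolynomial.X j : MvPolynomial (Fin (n + 1)) ℂ) ∈
        ξ.asHomogeneousIdeal.toIdeal.primeCompl := by
      have h2 : i (genericPoint X.scheme) ∈
          ⨆ j, Proj.basicOpen (projGrading n) (MvPolynomial.X j) := by
        rw [iSup_basicOpen_X_eq_top]; trivial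
      obtain ⟨j, hj⟩ := TopologicalSpace.Opens.mem_iSup.mp h2
      exact ⟨j, hj⟩
    have h2 := toSpecZero_appTop (X_mem_projGrading j) one_pos
    have h3 : X.str.appTop =
        (Spec.map (CommRingCat.ofHom (algebraMap ℂ (projGrading n 0)))).appTop ≫
          (Proj.toSpecZero (projGrading n)).appTop ≫ i.appTop := by
      rw [← hi, complexProjectiveSpaceStr, Scheme.Hom.comp_appTop, Scheme.Hom.comp_appTop,
        Category.assoc]
    have h4 : (Scheme.ΓSpecIso (CommRingCat.of ℂ)).inv ≫ X.str.appTop ≫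
        X.scheme.presheaf.germ ⊤ (genericPoint X.scheme) trivial =
        CommRingCat.ofHom (algebraMap ℂ (projGrading n 0)) ≫
        CommRingCat.ofHom (fromZeroRingHom (projGrading n) (Submonoid.powers (MvPolynomial.X j))) ≫
        CommRingCat.ofHom (HomogeneousLocalization.mapId (projGrading n)
          (Submonoid.powers_le.mpr hj)) ≫ Ψ := by
      rw [← h1 _ hj, ← reassoc_of% h2, h3]
      have h5 : X.scheme.presheaf.germ ⊤ (genericPoint X.scheme) trivial =
        X.scheme.presheaf.map (homOfLE le_top).op ≫ X.scheme.presheaf.germ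
          (i ⁻¹ᵁ Proj.basicOpen _ (MvPolynomial.X j)) (genericPoint X.scheme) hj :=
        (X.scheme.presheaf.germ_res _ _ _).symm
      rw [h5, Scheme.Hom.naturality_assoc]
      simp only [Category.assoc, ← Scheme.ΓSpecIso_inv_naturality_assoc]
      rfl
    have h6 := congrArg (fun φ => φ.hom c) h4
    exact h6.symm

theorem coordRatio_self {S : Submonoid (MvPolynomial (Fin (n + 1)) ℂ)} {j : Fin (n + 1)}
    (hj : MvPolynomial.X j ∈ S) : coordRatio j hj = 1 := by
  apply val_injective
  rw [coordRatio, val_mk, val_one]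
  exact Localization.mk_self ⟨_, hj⟩

theorem nonempty_opens_iff {U : X.scheme.Opens} : Nonempty U ↔ genericPoint X.scheme ∈ U := by
  refine Iff.trans ?_ ((genericPoint_spec X.scheme).mem_open_set_iff U.isOpen).symm
  simp

/-- The coordinates are the pull-backs of `Xᵢ / Xⱼ` for a fixed `j` with `Xⱼ` nonzero on `X`. As
`X` is closed in projective space, regular functions on `D₊(Xⱼ) ∩ X` are restrictions of
polynomials in the `Xᵢ / Xⱼ`. -/
theorem nonempty_projectiveCoordinates : Nonempty (ProjectiveCoordinates X) := by
  obtain ⟨n, i, hcl, hi⟩ := X.projective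
  obtain ⟨ξ, Ψ, hξ, hloc, hc, hgerm⟩ := exists_local_hom X i hi
  let U : Fin (n + 1) → X.scheme.Opens := fun j =>
    i ⁻¹ᵁ Proj.basicOpen (projGrading n) (MvPolynomial.X j)
  have hcover : ∀ x, ∃ j, x ∈ U j := fun x => by
    have h2 : i x ∈ ⨆ j, Proj.basicOpen (projGrading n) (MvPolynomial.X j) := by
      rw [iSup_basicOpen_X_eq_top]; trivial
    obtain ⟨j, hj⟩ := TopologicalSpace.Opens.mem_iSup.mp h2
    exact ⟨j, hj⟩
  have hne : ∀ j, Nonempty (U j) ↔ MvPolynomial.X j ∈ ξ.asHomogeneousIdeal.toIdeal.primeCompl :=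
    fun j => (nonempty_opens_iff X).trans (hξ _)
  obtain ⟨j₀, hj₀⟩ := hcover (genericPoint X.scheme)
  have hj₀ := (hξ _).mp hj₀
  let y : Fin (n + 1) → X.RatFunc := fun i => Ψ (coordRatio i hj₀)
  have hy : ∀ j, y j ≠ 0 ↔ Nonempty (U j) := by
    intro j
    rw [hne]
    constructor
    · intro h
      have h2 := hloc _ (isUnit_iff_ne_zero.mpr h)
      rw [← HomogeneousLocalization.isUnit_iff_isUnit_val, coordRatio, val_mk,
        Localization.mk_eq_mk'] at h2
      exact (IsLocalization.AtPrime.isUnit_mk'_iff _ ξ.asHomogeneousIdeal.toIdeal _ _).mp h2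
    · intro hj
      have h2 := congrArg Ψ (coordRatio_mul j hj₀ hj)
      rw [map_mul, coordRatio_self, map_one] at h2
      exact left_ne_zero_of_mul_eq_one h2
  refine ⟨⟨n, y, U, hcover, fun j => IsAffineOpen.preimage
    (Proj.isAffineOpen_basicOpen (projGrading n) _ (X_mem_projGrading j) one_pos) i, hy, ?_⟩⟩
  intro j hUj
  have hj := (hne j).mp hUj
  have hratio : ∀ i, y i * (y j)⁻¹ = Ψ (coordRatio i hj) := fun i => by
    rw [← div_eq_mul_inv, div_eq_iff ((hy j).mpr hUj), ← map_mul, coordRatio_mul]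
  have hgerm' : ∀ a, X.scheme.germToFunctionField (U j)
      (i.app _ (Proj.awayToSection (projGrading n) (MvPolynomial.X j) a)) =
        Ψ (HomogeneousLocalization.mapId (projGrading n) (Submonoid.powers_le.mpr hj) a) :=
    fun a => hgerm _ _ a
  simp_rw [hratio]
  refine Set.Subset.antisymm ?_ fun f hf => ?_
  · rintro _ ⟨s, rfl⟩
    obtain ⟨t, rfl⟩ := i.app_surjective _
      (Proj.isAffineOpen_basicOpen (projGrading n) _ (X_mem_projGrading j) one_pos) s
    obtain ⟨a, rfl⟩ := (Proj.basicOpenIsoAway (projGrading n) _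
      (X_mem_projGrading j) one_pos).commRingCatIsoToRingEquiv.surjective t
    refine Set.mem_of_eq_of_mem (hgerm' a) ?_
    obtain ⟨N, p, hp, rfl⟩ := Away.mk_surjective (projGrading n) (X_mem_projGrading j) a
    have h1 : HomogeneousLocalization.mapId (projGrading n) (Submonoid.powers_le.mpr hj)
        (Away.mk (projGrading n) (X_mem_projGrading j) N p hp) =
        p.eval₂ (scalarHom _) (fun i => coordRatio i hj) := by
      refine Eq.trans (HomogeneousLocalization.map_mk _ _ _)
        (mk_eq_eval₂_coordRatio hj (N := N • 1) (s := MvPolynomial.X j ^ N) hp ?_ ?_ ?_)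
      · exact SetLike.pow_mem_graded N (X_mem_projGrading j)
      · exact pow_mem hj N
      · rw [smul_eq_mul, mul_one]
    rw [h1, MvPolynomial.hom_eval₂, SetLike.mem_coe, Algebra.adjoin_range_eq_range_aeval]
    refine ⟨p, ?_⟩
    have h2 : Ψ.comp (scalarHom _) = algebraMap ℂ X.RatFunc := RingHom.ext hc
    rw [h2]
    rfl
  · induction hf using Algebra.adjoin_induction with
    | mem f hf =>
      obtain ⟨i', rfl⟩ := hf
      refine ⟨_, (hgerm' (coordRatio i' (Submonoid.mem_powers _))).trans ?_⟩
      congr 1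
    | algebraMap c => exact ⟨X.scalars (U j) c, germToFunctionField_scalars _ c⟩
    | add f g _ _ hf hg =>
      obtain ⟨a, rfl⟩ := hf
      obtain ⟨b, rfl⟩ := hg
      exact ⟨a + b, map_add _ _ _⟩
    | mul f g _ _ hf hg =>
      obtain ⟨a, rfl⟩ := hf
      obtain ⟨b, rfl⟩ := hg
      exact ⟨a * b, map_mul _ _ _⟩

/-! ### Finiteness of spaces of sections -/

variable {X}

theorem ordAlong_pos_of_not_isUnit {z : X.PrimeDivisor} {a : X.scheme.presheaf.stalk z.1}
    (ha0 : a ≠ 0) (ha : ¬ IsUnit a) : 0 < X.ordAlong (algebraMap _ X.RatFunc a) z := by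
  have h0 : algebraMap _ X.RatFunc a ≠ 0 :=
    (map_ne_zero_iff _ (IsFractionRing.injective _ X.RatFunc)).mpr ha0
  refine lt_of_le_of_ne (ordAlong_nonneg_iff.mpr ⟨a, rfl⟩) fun h => ha ?_
  obtain ⟨b, hb⟩ := ordAlong_nonneg_iff.mp (X.ordAlong_inv h0 z ▸ (by rw [← h]; rfl) :
    0 ≤ X.ordAlong (algebraMap _ X.RatFunc a)⁻¹ z)
  refine IsUnit.of_mul_eq_one b (IsFractionRing.injective _ X.RatFunc ?_)
  rw [map_mul, hb, map_one, mul_inv_cancel₀ h0]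

theorem ordAlong_germ_nonneg {U : X.scheme.Opens} [Nonempty U] (a : Γ(X.scheme, U))
    {z : X.PrimeDivisor} (hz : z.1 ∈ U) :
    0 ≤ X.ordAlong (X.scheme.germToFunctionField U a) z :=
  ordAlong_nonneg_iff.mpr ⟨_, Scheme.algebraMap_germ_eq_germToFunctionField X.scheme hz a⟩

theorem exists_ordAlong_germ_pos {U : X.scheme.Opens} (hU : IsAffineOpen U) [Nonempty U]
    {z : X.PrimeDivisor} (hz : z.1 ∈ U) :
    ∃ a : Γ(X.scheme, U), X.scheme.germToFunctionField U a ≠ 0 ∧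
      0 < X.ordAlong (X.scheme.germToFunctionField U a) z := by
  obtain ⟨t, ht⟩ := IsDiscreteValuationRing.exists_irreducible (X.scheme.presheaf.stalk z.1)
  let := TopCat.Presheaf.algebra_section_stalk X.scheme.presheaf ⟨z.1, hz⟩
  have := hU.isLocalization_stalk ⟨z.1, hz⟩
  obtain ⟨⟨b, s⟩, hbs⟩ := this.surj (hU.primeIdealOf ⟨z.1, hz⟩).asIdeal.primeCompl t
  have hs : IsUnit (algebraMap Γ(X.scheme, U) (X.scheme.presheaf.stalk z.1) s.1) :=
    this.map_units _ s
  have hb : algebraMap _ X.RatFunc (algebraMap Γ(X.scheme, U) (X.scheme.presheaf.stalk z.1) b) =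
      X.scheme.germToFunctionField U b :=
    Scheme.algebraMap_germ_eq_germToFunctionField X.scheme hz b
  have hb0 : algebraMap Γ(X.scheme, U) (X.scheme.presheaf.stalk z.1) b ≠ 0 := by
    rw [← hbs]; exact mul_ne_zero ht.ne_zero hs.ne_zero
  refine ⟨b, ?_, ?_⟩
  · rw [← hb]
    exact (map_ne_zero_iff _ (IsFractionRing.injective _ X.RatFunc)).mpr hb0
  · rw [← hb]
    refine ordAlong_pos_of_not_isUnit hb0 fun h => ht.not_isUnit ?_
    rw [← hbs] at h
    exact isUnit_of_mul_isUnit_left h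

theorem mul_mem_formsOfDegree {k K ι : Type*} [Field k] [Field K] [Algebra k K] {y : ι → K}
    {a b : ℕ} {s t : K} (hs : s ∈ formsOfDegree k y a) (ht : t ∈ formsOfDegree k y b) :
    s * t ∈ formsOfDegree k y (a + b) := by
  rw [mem_formsOfDegree] at *
  intro j hj
  have := mul_mem (hs j hj) (ht j hj)
  rwa [mul_mul_mul_comm, ← pow_add] at this

theorem pow_span_le_formsOfDegree {k K ι : Type*} [Field k] [Field K] [Algebra k K] (y : ι → K)
    (m : ℕ) : Submodule.span k (Set.range y) ^ m ≤ formsOfDegree k y m := by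
  induction m with
  | zero =>
    intro s hs
    rw [mem_formsOfDegree]
    intro j hj
    rw [pow_zero, mul_one]
    rw [pow_zero] at hs
    obtain ⟨a, rfl⟩ := Submodule.mem_one.mp hs
    exact Subalgebra.algebraMap_mem _ a
  | succ m ih =>
    rw [pow_succ, Submodule.mul_le]
    intro a ha b hb
    refine mul_mem_formsOfDegree (ih ha) ?_
    refine (Submodule.span_le.mpr ?_ : Submodule.span k (Set.range y) ≤ _) hb
    rintro _ ⟨i, rfl⟩
    rw [SetLike.mem_coe, mem_formsOfDegree]
    intro j hj
    rw [pow_one]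
    exact Algebra.subset_adjoin ⟨i, rfl⟩

theorem ordAlong_pow {f : X.RatFunc} (hf : f ≠ 0) (z : X.PrimeDivisor) (n : ℕ) :
    X.ordAlong (f ^ n) z = n * X.ordAlong f z := by
  induction n with
  | zero => rw [pow_zero, X.ordAlong_one, Nat.cast_zero, zero_mul]
  | succ n ih =>
    rw [pow_succ, X.ordAlong_mul (pow_ne_zero n hf) hf, ih]
    push_cast
    ring

namespace ProjectiveCoordinates

variable (c : ProjectiveCoordinates X)

theorem mem_adjoin_iff {j : Fin (c.n + 1)} (hj : c.y j ≠ 0) {f : X.RatFunc} :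
    f ∈ Algebra.adjoin ℂ (Set.range fun i => c.y i * (c.y j)⁻¹) ↔
      ∀ z : X.PrimeDivisor, z.1 ∈ c.U j → 0 ≤ X.ordAlong f z := by
  have := (c.ne_zero_iff j).mp hj
  rw [← SetLike.mem_coe, ← c.range_eq j]
  constructor
  · rintro ⟨a, rfl⟩ z hz
    exact ordAlong_germ_nonneg a hz
  · intro h
    obtain ⟨a, ha⟩ := exists_germToFunctionField_eq (c.isAffineOpen j) h
    exact ⟨a, ha⟩

theorem ne_zero_of_mem {j : Fin (c.n + 1)} {x : X.scheme} (hx : x ∈ c.U j) : c.y j ≠ 0 :=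
  (c.ne_zero_iff j).mpr ⟨⟨x, hx⟩⟩

/-- The ratio of two coordinates is a unit where neither of them vanishes. -/
theorem ordAlong_ratio {z : X.PrimeDivisor} {i j : Fin (c.n + 1)} (hi : z.1 ∈ c.U i)
    (hj : z.1 ∈ c.U j) : X.ordAlong (c.y i * (c.y j)⁻¹) z = 0 := by
  have h1 := c.ne_zero_of_mem hi
  have h2 := c.ne_zero_of_mem hj
  have h3 := (c.mem_adjoin_iff h2).mp (Algebra.subset_adjoin ⟨i, rfl⟩) z hj
  have h4 := (c.mem_adjoin_iff h1).mp (Algebra.subset_adjoin ⟨j, rfl⟩) z hi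
  have h5 : c.y j * (c.y i)⁻¹ = (c.y i * (c.y j)⁻¹)⁻¹ := by
    rw [mul_inv, inv_inv, mul_comm]
  simp only at h3 h4
  rw [h5, X.ordAlong_inv (mul_ne_zero h1 (inv_ne_zero h2))] at h4
  omega

/-- Some nonzero form `G` vanishes along the divisor `D`. Its order of vanishing along `z` is
computed as that of `G / yⱼ ^ m`, for any `j` with `z` in `Uⱼ`. -/
def FormBound (D : X.Divisor) : Prop :=
  ∃ m, ∃ G ∈ formsOfDegree ℂ c.y m, G ≠ 0 ∧
    ∀ j, ∀ z : X.PrimeDivisor, z.1 ∈ c.U j → D z ≤ X.ordAlong (G * (c.y j)⁻¹ ^ m) z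

theorem formBound_add {D D' : X.Divisor} (h : c.FormBound D) (h' : c.FormBound D') :
    c.FormBound (D + D') := by
  obtain ⟨m, G, hG, hG0, hGD⟩ := h
  obtain ⟨m', G', hG', hG0', hGD'⟩ := h'
  refine ⟨m + m', G * G', mul_mem_formsOfDegree hG hG', mul_ne_zero hG0 hG0', fun j z hz => ?_⟩
  have hj := inv_ne_zero (c.ne_zero_of_mem hz)
  rw [pow_add, mul_mul_mul_comm, X.ordAlong_mul (mul_ne_zero hG0 (pow_ne_zero _ hj))
    (mul_ne_zero hG0' (pow_ne_zero _ hj))]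
  exact add_le_add (hGD j z hz) (hGD' j z hz)

theorem formBound_of_nonpos {D : X.Divisor} (h : D ≤ 0) : c.FormBound D := by
  refine ⟨0, 1, ?_, one_ne_zero, fun j z hz => ?_⟩
  · rw [mem_formsOfDegree]
    intro j hj
    rw [pow_zero, mul_one]
    exact one_mem _
  · rw [pow_zero, mul_one, X.ordAlong_one]
    exact h z

open Classical in
/-- A regular function on `Uⱼ` vanishing along `z` becomes a form after multiplication by a power of
`yⱼ`. -/
theorem formBound_single_one (z : X.PrimeDivisor) : c.FormBound (Finsupp.single z 1) := by
  obtain ⟨j, hzj⟩ := c.exists_mem z.1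
  have hj := c.ne_zero_of_mem hzj
  have : Nonempty (c.U j) := ⟨⟨z.1, hzj⟩⟩
  obtain ⟨a, ha0, ha⟩ := exists_ordAlong_germ_pos (c.isAffineOpen j) hzj
  set h := X.scheme.germToFunctionField (c.U j) a with hh
  have hmem : h ∈ Algebra.adjoin ℂ (Set.range fun i => c.y i * (c.y j)⁻¹) := by
    rw [← SetLike.mem_coe, ← c.range_eq j]
    exact ⟨a, rfl⟩
  obtain ⟨N, hN⟩ := exists_forall_mul_pow_mem c.y j hj hmem
  have hG := pow_span_le_formsOfDegree c.y N (hN N le_rfl)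
  have hG0 : h * c.y j ^ N ≠ 0 := mul_ne_zero ha0 (pow_ne_zero N hj)
  refine ⟨N, h * c.y j ^ N, hG, hG0, fun i w hw => ?_⟩
  have hi := c.ne_zero_of_mem hw
  by_cases hwz : z = w
  · subst hwz
    rw [Finsupp.single_eq_same, mul_assoc, ← mul_pow, X.ordAlong_mul ha0
      (pow_ne_zero N (mul_ne_zero hj (inv_ne_zero hi))), ordAlong_pow
      (mul_ne_zero hj (inv_ne_zero hi)), c.ordAlong_ratio hzj hw]
    omega
  · rw [Finsupp.single_eq_of_ne' hwz]
    exact (c.mem_adjoin_iff hi).mp (mem_formsOfDegree.mp hG i hi) w hw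

theorem formBound (D : X.Divisor) : c.FormBound D := by
  induction D using Finsupp.induction_linear with
  | zero => exact c.formBound_of_nonpos le_rfl
  | add D D' h h' => exact c.formBound_add h h'
  | single z a =>
    rcases le_total a 0 with ha | ha
    · refine c.formBound_of_nonpos fun w => ?_
      classical
      rw [Finsupp.single_apply]
      split_ifs <;> simp [ha]
    · obtain ⟨n, rfl⟩ := Int.eq_ofNat_of_zero_le ha
      induction n with
      | zero => exact c.formBound_of_nonpos (by simp)
      | succ n ih =>
        rw [Nat.cast_succ, Finsupp.single_add]
        exact c.formBound_add (ih (Int.natCast_nonneg n)) (c.formBound_single_one z)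

end ProjectiveCoordinates

/-- Multiplication by a form of degree `m` that vanishes along `D` embeds the sections of `D` into
the forms of degree `m`. -/
instance finite_sections (D : X.Divisor) : Module.Finite ℂ (X.sections D) := by
  obtain ⟨c⟩ := nonempty_projectiveCoordinates X
  obtain ⟨m, G, hG, hG0, hGD⟩ := c.formBound D
  have hy : ∃ j, c.y j ≠ 0 := by
    obtain ⟨j, hj⟩ := c.exists_mem (genericPoint X.scheme)
    exact ⟨j, c.ne_zero_of_mem hj⟩
  have := finite_formsOfDegree (k := ℂ) hy m
  have hle : (X.sections D).map (LinearMap.mulLeft ℂ G) ≤ formsOfDegree ℂ c.y m := by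
    rintro _ ⟨f, hf, rfl⟩
    rw [LinearMap.mulLeft_apply]
    rcases eq_or_ne f 0 with rfl | hf0
    · rw [mul_zero]; exact zero_mem _
    rw [mem_formsOfDegree]
    intro j hj
    rw [c.mem_adjoin_iff hj]
    intro z hz
    rw [mul_right_comm, X.ordAlong_mul (mul_ne_zero hG0 (pow_ne_zero _ (inv_ne_zero hj))) hf0]
    have h1 := mem_sections_iff.mp hf hf0 z
    have h2 := hGD j z hz
    omega
  have h2 : Module.Finite ℂ ((X.sections D).map (LinearMap.mulLeft ℂ G)) :=
    Submodule.finiteDimensional_of_le hle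
  exact Module.Finite.equiv (Submodule.equivMapOfInjective (LinearMap.mulLeft ℂ G)
    (mul_right_injective₀ hG0) (X.sections D)).symm

/-- The function `1` is a section of an effective divisor, and `finrank` does not take its default
value `0` since the space of sections is finite-dimensional. -/
theorem h0_ne_zero_of_mem {L : X.Pic} (hL : L ∈ X.effectiveMonoid) : X.h0 L ≠ 0 := by
  obtain ⟨D, hD, rfl⟩ := hL
  have hD : 0 ≤ D := hD
  change Module.finrank ℂ (X.sections D) ≠ 0
  have h1 : (1 : X.RatFunc) ∈ X.sections D := mem_sections_iff.mpr fun _ z => by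
    rw [X.ordAlong_one, zero_add]; exact hD z
  have : Nontrivial (X.sections D) := ⟨⟨⟨1, h1⟩, 0, fun h => one_ne_zero (congrArg Subtype.val h)⟩⟩
  exact Module.finrank_pos.ne'

/-- Rational functions algebraic over `ℂ` are constant. -/
theorem ordAlong_eq_zero_of_isAlgebraic {f : X.RatFunc} (hf : IsAlgebraic ℂ f)
    (z : X.PrimeDivisor) : X.ordAlong f z = 0 := by
  have hint : IsIntegral ℂ f := hf.isIntegral
  have hdeg := IsAlgClosed.degree_eq_one_of_irreducible ℂ (minpoly.irreducible hint)
  obtain ⟨c, rfl⟩ := minpoly.mem_range_of_degree_eq_one ℂ f hdeg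
  rcases eq_or_ne c 0 with rfl | hc
  · rw [map_zero, ordAlong, Scheme.ord_zero]; rfl
  · exact ordAlong_algebraMap hc z

end SmoothProjectiveVariety

/-! ### Birational morphisms and prime divisors -/

/-- The only proper generization of a point of codimension one is the generic point. -/
theorem Order.eq_genericPoint_of_coheight_eq_one {S : Scheme} [IsIntegral S] {z w : S}
    (hz : Order.coheight z = 1) (h : w ⤳ z) (hne : w ≠ z) : w = genericPoint S := by
  have hlt : z < w := by
    refine lt_of_le_not_ge h fun h' => hne ?_
    exact (Specializes.antisymm h h').eq
  have h1 := Order.coheight_add_one_le hlt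
  rw [hz] at h1
  have h2 : Order.coheight w = 0 := by
    have h3 : Order.coheight w + 1 ≤ 0 + 1 := by rw [zero_add]; exact h1
    exact nonpos_iff_eq_zero.mp ((ENat.add_le_add_iff_right ENat.one_ne_top).mp h3)
  have h4 := Order.coheight_eq_zero.mp h2
  have h5 : genericPoint S ≤ w := h4 (genericPoint_specializes w)
  exact (Specializes.antisymm h5 (genericPoint_specializes w)).eq

/-- The points of codimension one outside a nonempty open set are generic points of irreducible
components of its complement. -/
theorem finite_coheight_eq_one_notMem {S : Scheme} [IsIntegral S]
    [TopologicalSpace.NoetherianSpace S] {U : S.Opens} (hU : genericPoint S ∈ U) :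
    {z : S | Order.coheight z = 1 ∧ z ∉ U}.Finite := by
  obtain ⟨T, hT, hcl, hirr, hsup⟩ :=
    TopologicalSpace.NoetherianSpace.exists_finite_set_isClosed_irreducible
      (α := S) U.isOpen.isClosed_compl
  refine Set.Finite.of_finite_image (f := fun z => closure {z}) (hT.subset ?_) fun z _ w _ h =>
    (inseparable_iff_closure_eq.mpr h).eq
  rintro _ ⟨z, ⟨hz, hzU⟩, rfl⟩
  have hz' : z ∈ ⋃₀ T := hsup ▸ hzU
  obtain ⟨t, ht, hzt⟩ := hz'
  have hgen := (hirr t ht).isGenericPoint_genericPoint (hcl t ht)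
  set w := (hirr t ht).genericPoint
  have hwz : w ⤳ z := hgen.specializes hzt
  have hwz' : w = z := by
    by_contra hne
    have hw : w ∈ (U : Set S)ᶜ := by
      rw [hsup]
      exact ⟨t, ht, hgen.mem⟩
    rw [Order.eq_genericPoint_of_coheight_eq_one hz hwz hne] at hw
    exact hw hU
  rw [← hwz']
  simp only [hgen.def]
  exact ht

namespace SmoothProjectiveVariety

/-- Projective space over `ℂ` is proper; the map `ℂ → ℂ[X₀, …, Xₙ]₀` is surjective. -/
instance isProper_complexProjectiveSpaceStr (n : ℕ) : IsProper (complexProjectiveSpaceStr n) := by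
  have : IsScalarTower ℂ (projGrading n 0) (MvPolynomial (Fin (n + 1)) ℂ) :=
    IsScalarTower.of_algebraMap_eq (R := ℂ) (S := projGrading n 0)
      (A := MvPolynomial (Fin (n + 1)) ℂ) fun _ => rfl
  have : Algebra.FiniteType (projGrading n 0) (MvPolynomial (Fin (n + 1)) ℂ) :=
    Algebra.FiniteType.of_restrictScalars_finiteType ℂ (projGrading n 0) _
  have h : Function.Surjective (algebraMap ℂ (projGrading n 0)) := by
    rintro ⟨p, hp⟩
    have hp : p.IsHomogeneous 0 := hp
    obtain ⟨c, rfl⟩ : ∃ c, p = MvPolynomial.C c := by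
      rw [← MvPolynomial.totalDegree_zero_iff_isHomogeneous,
        MvPolynomial.totalDegree_eq_zero_iff_eq_C] at hp
      exact ⟨_, hp⟩
    exact ⟨c, rfl⟩
  have : IsClosedImmersion (Spec.map (CommRingCat.ofHom (algebraMap ℂ (projGrading n 0)))) :=
    IsClosedImmersion.spec_of_surjective _ h
  rw [complexProjectiveSpaceStr]
  infer_instance

instance isProper_str (X : SmoothProjectiveVariety) : IsProper X.str := by
  obtain ⟨n, i, hi, h⟩ := X.projective
  rw [← h]
  infer_instance

instance compactSpace_scheme (X : SmoothProjectiveVariety) : CompactSpace X.scheme :=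
  QuasiCompact.compactSpace_of_compactSpace X.str

instance isNoetherian_scheme (X : SmoothProjectiveVariety) : IsNoetherian X.scheme := {}

variable {X Y : SmoothProjectiveVariety} {π : Y.scheme ⟶ X.scheme}

theorem isProper_of_comp_str (h : π ≫ X.str = Y.str) : IsProper π := by
  have : IsProper (π ≫ X.str) := by rw [h]; infer_instance
  exact IsProper.of_comp π X.str

section

variable (e : Y.scheme.PartialIso X.scheme) (he : e.iso.hom ≫ e.target.ι = e.source.ι ≫ π)

include he

theorem isOpenImmersion_source_comp : IsOpenImmersion (e.source.ι ≫ π) := by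
  rw [← he]; infer_instance

theorem map_genericPoint : π (genericPoint Y.scheme) = genericPoint X.scheme := by
  have := isOpenImmersion_source_comp e he
  have : Nonempty e.source := by
    obtain ⟨x, hx⟩ := e.dense_source.nonempty
    exact ⟨⟨x, hx⟩⟩
  rw [← genericPoint_eq_of_isOpenImmersion (e.source.ι ≫ π),
    ← genericPoint_eq_of_isOpenImmersion e.source.ι]
  rfl

theorem bijective_stalkMap_of_mem_source {y : Y.scheme} (hy : y ∈ e.source) :
    Function.Bijective (π.stalkMap y) := by
  have := isOpenImmersion_source_comp e he
  let y' : (e.source : Scheme) := ⟨y, hy⟩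
  have h1 : IsIso ((e.source.ι ≫ π).stalkMap y') := inferInstance
  rw [Scheme.Hom.stalkMap_comp] at h1
  have h2 : IsIso (e.source.ι.stalkMap y') := inferInstance
  have h3 : IsIso (π.stalkMap (e.source.ι y')) :=
    @IsIso.of_isIso_comp_right _ _ _ _ _ _ _ h2 h1
  exact ConcreteCategory.bijective_of_isIso (π.stalkMap (e.source.ι y'))

theorem injOn_source : Set.InjOn π (e.source : Set Y.scheme) := by
  have := isOpenImmersion_source_comp e he
  intro y hy y' hy' h
  have := (e.source.ι ≫ π).isOpenEmbedding.injective (a₁ := ⟨y, hy⟩) (a₂ := ⟨y', hy'⟩) h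
  exact congrArg Subtype.val this

theorem exists_mem_source {x : X.scheme} (hx : x ∈ e.target) : ∃ y ∈ e.source, π y = x := by
  refine ⟨(e.iso.inv ⟨x, hx⟩).1, (e.iso.inv ⟨x, hx⟩).2, ?_⟩
  have h1 : (e.source.ι ≫ π) (e.iso.inv ⟨x, hx⟩) = π (e.iso.inv ⟨x, hx⟩).1 := rfl
  rw [← h1, ← he]
  have h2 : (e.iso.inv ≫ e.iso.hom ≫ e.target.ι) ⟨x, hx⟩ = x := by
    rw [Iso.inv_hom_id_assoc]; rfl
  exact h2

theorem map_mem_target {y : Y.scheme} (hy : y ∈ e.source) : π y ∈ e.target := by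
  have h1 : (e.iso.hom ≫ e.target.ι) ⟨y, hy⟩ = π y := by rw [he]; rfl
  rw [← h1]
  exact (e.iso.hom ⟨y, hy⟩).2

theorem surjective_of_isBirational (h : π ≫ X.str = Y.str) : Function.Surjective π := by
  have := isProper_of_comp_str h
  have hcl : IsClosed (Set.range π) := π.isClosedMap.isClosed_range
  intro x
  have h1 : genericPoint X.scheme ∈ Set.range π := ⟨_, map_genericPoint e he⟩
  exact (genericPoint_specializes x).mem_closed hcl h1

end

/-- The pull-back of rational functions along a dominant morphism. -/
noncomputable def ratFuncHom (h : π ≫ X.str = Y.str)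
    (hη : π (genericPoint Y.scheme) = genericPoint X.scheme) : X.RatFunc →ₐ[ℂ] Y.RatFunc where
  toRingHom := (X.scheme.presheaf.stalkSpecializes (specializes_of_eq hη) ≫
    π.stalkMap (genericPoint Y.scheme)).hom
  commutes' := fun c => by
    have h1 : X.str.appTop ≫ X.scheme.presheaf.germ ⊤ (genericPoint X.scheme)
        (TopologicalSpace.Opens.mem_top _) ≫
        X.scheme.presheaf.stalkSpecializes (specializes_of_eq hη) ≫
          π.stalkMap (genericPoint Y.scheme) =
        Y.str.appTop ≫ Y.scheme.presheaf.germ ⊤ (genericPoint Y.scheme)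
          (TopologicalSpace.Opens.mem_top _) := by
      rw [TopCat.Presheaf.germ_stalkSpecializes_assoc, Scheme.Hom.germ_stalkMap, ← h,
        Scheme.Hom.comp_appTop, Category.assoc]
      rfl
    exact congrArg (fun φ => φ.hom ((Scheme.ΓSpecIso (CommRingCat.of ℂ)).inv.hom c)) h1

/-- The pull-back of rational functions extends the maps between local rings. -/
theorem algebraMap_stalkMap (h : π ≫ X.str = Y.str)
    (hη : π (genericPoint Y.scheme) = genericPoint X.scheme) (y : Y.scheme)
    (a : X.scheme.presheaf.stalk (π y)) :
    algebraMap (Y.scheme.presheaf.stalk y) Y.RatFunc (π.stalkMap y a) =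
      ratFuncHom h hη (algebraMap (X.scheme.presheaf.stalk (π y)) X.RatFunc a) := by
  have h1 := π.stalkSpecializes_stalkMap (genericPoint Y.scheme) y (genericPoint_specializes y)
  have h2 : X.scheme.presheaf.stalkSpecializes (genericPoint_specializes (π y)) ≫
      X.scheme.presheaf.stalkSpecializes (specializes_of_eq hη) =
      X.scheme.presheaf.stalkSpecializes
        (π.base.hom.map_specializes (genericPoint_specializes y)) :=
    X.scheme.presheaf.stalkSpecializes_comp _ _
  rw [← h2, Category.assoc] at h1
  exact (congrArg (fun φ => φ.hom a) h1).symm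

/-- If a morphism induces an isomorphism of function fields and maps `y` to a point of codimension
one, then it induces an isomorphism of the local rings at `y`: a discrete valuation ring is not
dominated by any other local ring in its fraction field. -/
theorem bijective_stalkMap_of_coheight_eq_one (h : π ≫ X.str = Y.str)
    (hη : π (genericPoint Y.scheme) = genericPoint X.scheme)
    (hbij : Function.Bijective (ratFuncHom h hη)) {y : Y.scheme}
    (hy : Order.coheight (π y) = 1) : Function.Bijective (π.stalkMap y) := by
  have := isDiscreteValuationRing_stalk hy
  constructor
  · intro a b hab
    have h1 := congrArg (algebraMap (Y.scheme.presheaf.stalk y) Y.RatFunc) hab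
    rw [algebraMap_stalkMap h hη, algebraMap_stalkMap h hη] at h1
    exact IsFractionRing.injective _ X.RatFunc (hbij.1 h1)
  · intro g
    obtain ⟨f, hf⟩ := hbij.2 (algebraMap (Y.scheme.presheaf.stalk y) Y.RatFunc g)
    have key : ∀ a, algebraMap (X.scheme.presheaf.stalk (π y)) X.RatFunc a = f →
        π.stalkMap y a = g := fun a ha => by
      apply IsFractionRing.injective (Y.scheme.presheaf.stalk y) Y.RatFunc
      rw [algebraMap_stalkMap h hη, ha, hf]
    rcases eq_or_ne f 0 with rfl | hf0
    · exact ⟨0, key 0 (map_zero _)⟩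
    rcases ValuationRing.isInteger_or_isInteger (X.scheme.presheaf.stalk (π y)) f with
      ⟨a, ha⟩ | ⟨b, hb⟩
    · exact ⟨a, key a ha⟩
    · have h1 : π.stalkMap y b * g = 1 := by
        apply IsFractionRing.injective (Y.scheme.presheaf.stalk y) Y.RatFunc
        rw [map_mul, algebraMap_stalkMap h hη, hb, ← hf, ← map_mul, inv_mul_cancel₀ hf0, map_one,
          map_one]
      have h2 : IsUnit b := isUnit_of_map_unit (π.stalkMap y).hom b (IsUnit.of_mul_eq_one _ h1)
      obtain ⟨a, ha⟩ := h2.exists_right_inv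
      refine ⟨a, key a ?_⟩
      have := congrArg (algebraMap _ X.RatFunc) ha
      rw [map_mul, hb, map_one] at this
      field_simp at this
      exact this

theorem coheight_map_eq {y : Y.scheme} (hbij : Function.Bijective (π.stalkMap y)) :
    Order.coheight (π y) = Order.coheight y := by
  have h1 := ringKrullDim_eq_of_ringEquiv (RingEquiv.ofBijective (π.stalkMap y).hom hbij)
  rw [ringKrullDim_stalk_eq_coheight, ringKrullDim_stalk_eq_coheight] at h1
  exact_mod_cast h1

theorem ordAlong_irreducible {z : X.PrimeDivisor} {t : X.scheme.presheaf.stalk z.1}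
    (ht : Irreducible t) : X.ordAlong (algebraMap _ X.RatFunc t) z = 1 := by
  have : Ring.KrullDimLE 1 (X.scheme.presheaf.stalk z.1) := krullDimLE_of_coheight_le z.2.le
  rw [ordAlong, Scheme.ord_eq_iff z.2
    ((map_ne_zero_iff _ (IsFractionRing.injective _ X.RatFunc)).mpr ht.ne_zero)]
  exact Ring.ordFrac_irreducible ht

/-- Corresponding prime divisors with isomorphic local rings have the same order of vanishing. -/
theorem ordAlong_ratFuncHom (h : π ≫ X.str = Y.str)
    (hη : π (genericPoint Y.scheme) = genericPoint X.scheme) {x : X.PrimeDivisor}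
    {y : Y.PrimeDivisor} (hyx : π y.1 = x.1) (hbij : Function.Bijective (π.stalkMap y.1))
    (f : X.RatFunc) : Y.ordAlong (ratFuncHom h hη f) y = X.ordAlong f x := by
  obtain ⟨x, hx⟩ := x
  subst hyx
  have := isDiscreteValuationRing_stalk hx
  obtain ⟨t, ht⟩ := IsDiscreteValuationRing.exists_irreducible (X.scheme.presheaf.stalk (π y.1))
  let E := RingEquiv.ofBijective (π.stalkMap y.1).hom hbij
  have ht' : Irreducible (π.stalkMap y.1 t) := (MulEquiv.irreducible_iff E).mpr ht
  have key : ∀ a : X.scheme.presheaf.stalk (π y.1), a ≠ 0 →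
      Y.ordAlong (ratFuncHom h hη (algebraMap _ X.RatFunc a)) y =
        X.ordAlong (algebraMap _ X.RatFunc a) ⟨π y.1, hx⟩ := by
    intro a ha
    obtain ⟨n, u, rfl⟩ := IsDiscreteValuationRing.eq_unit_mul_pow_irreducible ha ht
    have hu : IsUnit (π.stalkMap y.1 u) := u.isUnit.map (π.stalkMap y.1).hom
    rw [← algebraMap_stalkMap, map_mul, map_pow, map_mul, map_pow, map_mul, map_pow,
      ordAlong_mul, ordAlong_mul, ordAlong_pow, ordAlong_pow, ordAlong_irreducible ht',
      ordAlong_irreducible (z := ⟨π y.1, hx⟩) ht, ordAlong_eq_zero_of_isUnit hu,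
      ordAlong_eq_zero_of_isUnit (z := ⟨π y.1, hx⟩) u.isUnit]
    all_goals
      first
      | exact pow_ne_zero _ ((map_ne_zero_iff _ (IsFractionRing.injective _ _)).mpr ht'.ne_zero)
      | exact pow_ne_zero _ ((map_ne_zero_iff _ (IsFractionRing.injective _ _)).mpr ht.ne_zero)
      | exact (map_ne_zero_iff _ (IsFractionRing.injective _ _)).mpr ht'.ne_zero
      | exact (map_ne_zero_iff _ (IsFractionRing.injective _ _)).mpr ht.ne_zero
      | exact (map_ne_zero_iff _ (IsFractionRing.injective _ _)).mpr hu.ne_zero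
      | exact (map_ne_zero_iff _ (IsFractionRing.injective _ _)).mpr u.isUnit.ne_zero
  rcases eq_or_ne f 0 with rfl | hf
  · rw [map_zero, ordAlong, ordAlong, Scheme.ord_zero, Scheme.ord_zero]; rfl
  obtain ⟨a, b, hb, rfl⟩ := IsFractionRing.div_surjective (A := X.scheme.presheaf.stalk (π y.1)) f
  have hb0 : b ≠ 0 := nonZeroDivisors.ne_zero hb
  have ha0 : a ≠ 0 := by
    rintro rfl
    exact hf (by rw [map_zero, zero_div])
  have hb' : algebraMap _ X.RatFunc b ≠ 0 :=
    (map_ne_zero_iff _ (IsFractionRing.injective _ X.RatFunc)).mpr hb0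
  have ha' : algebraMap _ X.RatFunc a ≠ 0 :=
    (map_ne_zero_iff _ (IsFractionRing.injective _ X.RatFunc)).mpr ha0
  rw [div_eq_mul_inv, map_mul, map_inv₀, X.ordAlong_mul ha' (inv_ne_zero hb'),
    X.ordAlong_inv hb', Y.ordAlong_mul ((map_ne_zero _).mpr ha')
      (inv_ne_zero ((map_ne_zero _).mpr hb')), Y.ordAlong_inv ((map_ne_zero _).mpr hb'),
    key a ha0, key b hb0]

/-- What is used of a birational morphism from `Y` to `X`: an isomorphism between the fields of
rational functions and an inclusion of the prime divisors of `X` into those of `Y`, compatible with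
orders of vanishing, which misses only finitely many prime divisors of `Y`. -/
structure PrimeDivisorTransfer (X Y : SmoothProjectiveVariety) where
  /-- The pull-back of rational functions. -/
  θ : X.RatFunc →ₐ[ℂ] Y.RatFunc
  bijective : Function.Bijective θ
  /-- The strict transform of prime divisors. -/
  σ : X.PrimeDivisor → Y.PrimeDivisor
  injective : Function.Injective σ
  ordAlong_eq : ∀ f x, Y.ordAlong (θ f) (σ x) = X.ordAlong f x
  finite_exceptional : (Set.range σ)ᶜ.Finite

theorem IsBirationalMorphism.nonempty_primeDivisorTransfer (hπ : IsBirationalMorphism π) :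
    Nonempty (PrimeDivisorTransfer X Y) := by
  obtain ⟨h, e, he⟩ := hπ
  have hη := map_genericPoint e he
  have hgen : genericPoint Y.scheme ∈ e.source := by
    obtain ⟨y, hy⟩ := e.dense_source.nonempty
    exact (genericPoint_specializes y).mem_open e.source.isOpen hy
  have hbij : Function.Bijective (ratFuncHom h hη) := by
    have h1 : IsIso (X.scheme.presheaf.stalkSpecializes (specializes_of_eq hη)) :=
      (X.scheme.presheaf.stalkCongr (.of_eq hη.symm)).isIso_hom
    have h2 := ConcreteCategory.bijective_of_isIso
      (X.scheme.presheaf.stalkSpecializes (specializes_of_eq hη))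
    exact (bijective_stalkMap_of_mem_source e he hgen).comp h2
  have hex : ∀ x : X.PrimeDivisor, ∃ y : Y.PrimeDivisor, π y.1 = x.1 ∧
      Function.Bijective (π.stalkMap y.1) ∧ (x.1 ∈ e.target → y.1 ∈ e.source) := by
    intro x
    obtain ⟨y, hy, hys⟩ : ∃ y, π y = x.1 ∧ (x.1 ∈ e.target → y ∈ e.source) := by
      -- Outside the locus of isomorphism, properness provides a preimage.
      by_cases hx : x.1 ∈ e.target
      · obtain ⟨y, hy, hyx⟩ := exists_mem_source e he hx
        exact ⟨y, hyx, fun _ => hy⟩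
      · obtain ⟨y, hy⟩ := surjective_of_isBirational e he h x.1
        exact ⟨y, hy, fun h => (hx h).elim⟩
    have hb : Function.Bijective (π.stalkMap y) :=
      bijective_stalkMap_of_coheight_eq_one h hη hbij (by rw [hy]; exact x.2)
    exact ⟨⟨y, by rw [← coheight_map_eq hb, hy]; exact x.2⟩, hy, hb, hys⟩
  choose σ hσ hσb hσs using hex
  refine ⟨⟨ratFuncHom h hη, hbij, σ, fun x x' hxx' => Subtype.ext ?_, fun f x =>
    ordAlong_ratFuncHom h hη (hσ x) (hσb x) f, ?_⟩⟩
  · rw [← hσ x, ← hσ x', hxx']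
  · refine Set.Finite.of_finite_image (f := Subtype.val)
      ((finite_coheight_eq_one_notMem hgen).subset ?_) Subtype.val_injective.injOn
    rintro _ ⟨z, hz, rfl⟩
    refine ⟨z.2, fun hzs => hz ?_⟩
    have hc := coheight_map_eq (bijective_stalkMap_of_mem_source e he hzs)
    refine ⟨⟨π z.1, by rw [hc]; exact z.2⟩, Subtype.ext ?_⟩
    exact injOn_source e he (hσs _ (map_mem_target e he hzs)) hzs (hσ _)

/-! ### The Picard group and exceptional divisors -/

/-- The rational functions vanishing to order at least `n` along `z`. -/
def ordGE (z : X.PrimeDivisor) (n : ℤ) : Submodule ℂ X.RatFunc where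
  carrier := {f | f ≠ 0 → n ≤ X.ordAlong f z}
  zero_mem' := fun h => (h rfl).elim
  add_mem' := by
    intro f g hf hg h
    rcases eq_or_ne f 0 with rfl | hf0
    · rw [zero_add] at h ⊢; exact hg h
    rcases eq_or_ne g 0 with rfl | hg0
    · rw [add_zero] at h ⊢; exact hf h
    exact (le_min (hf hf0) (hg hg0)).trans (Scheme.ord_add (x := z.1) h)
  smul_mem' := by
    intro c f hf h
    have hc : c ≠ 0 := left_ne_zero_of_smul h
    have hf0 : f ≠ 0 := right_ne_zero_of_smul h
    rw [Algebra.smul_def, X.ordAlong_mul ((map_ne_zero _).mpr hc) hf0, ordAlong_algebraMap hc,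
      zero_add]
    exact hf hf0

/-- The orders of vanishing along `z` of the nonzero elements of a finite-dimensional space `V` are
bounded above: the decreasing sequence of subspaces of `V` given by vanishing to order at least `n`
is stationary, and no nonzero function belongs to all of them. -/
theorem exists_forall_ordAlong_le (z : X.PrimeDivisor) (V : Submodule ℂ X.RatFunc)
    [Module.Finite ℂ V] : ∃ B : ℤ, ∀ f ∈ V, f ≠ 0 → X.ordAlong f z ≤ B := by
  let W : ℕ →o (Submodule ℂ V)ᵒᵈ :=
    ⟨fun n => OrderDual.toDual ((ordGE z (n : ℤ)).comap V.subtype), fun m n hmn => by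
      refine OrderDual.toDual_le_toDual.mpr (Submodule.comap_mono fun f hf h => ?_)
      exact (Int.ofNat_le.mpr hmn).trans (hf h)⟩
  obtain ⟨N, hN⟩ := IsArtinian.monotone_stabilizes W
  refine ⟨N, fun f hf hf0 => ?_⟩
  by_contra! hlt
  have h1 : (⟨f, hf⟩ : V) ∈ OrderDual.ofDual (W N) := fun _ => hlt.le
  have h2 := hN ((X.ordAlong f z).toNat + 1) (by omega)
  rw [h2] at h1
  have h3 : (((X.ordAlong f z).toNat + 1 : ℕ) : ℤ) ≤ X.ordAlong f z := h1 hf0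
  omega

/-- A rational function `f` without poles is algebraic over `ℂ`, as `ℂ[f]` is contained in the
finite-dimensional space of global sections of `𝒪_X`. -/
theorem isAlgebraic_of_forall_ordAlong_nonneg {f : X.RatFunc} (hf : ∀ z, 0 ≤ X.ordAlong f z) :
    IsAlgebraic ℂ f := by
  have key : ∀ g ∈ Algebra.adjoin ℂ {f}, ∀ z, 0 ≤ X.ordAlong g z := by
    intro g hg z
    induction hg using Algebra.adjoin_induction with
    | mem g hg => rw [Set.mem_singleton_iff.mp hg]; exact hf z
    | algebraMap c =>
      rcases eq_or_ne c 0 with rfl | hc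
      · exact ordAlong_nonneg_iff.mpr ⟨0, by rw [map_zero, map_zero]⟩
      · exact (ordAlong_algebraMap hc z).ge
    | add g h _ _ hg hh =>
      obtain ⟨a, rfl⟩ := ordAlong_nonneg_iff.mp hg
      obtain ⟨b, rfl⟩ := ordAlong_nonneg_iff.mp hh
      exact ordAlong_nonneg_iff.mpr ⟨a + b, map_add _ _ _⟩
    | mul g h _ _ hg hh =>
      obtain ⟨a, rfl⟩ := ordAlong_nonneg_iff.mp hg
      obtain ⟨b, rfl⟩ := ordAlong_nonneg_iff.mp hh
      exact ordAlong_nonneg_iff.mpr ⟨a * b, map_mul _ _ _⟩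
  have hle : Subalgebra.toSubmodule (Algebra.adjoin ℂ {f}) ≤ X.sections 0 := fun g hg =>
    mem_sections_iff.mpr fun _ z => by
      rw [Finsupp.coe_zero, Pi.zero_apply, add_zero]
      exact key g hg z
  have h1 : Module.Finite ℂ (Subalgebra.toSubmodule (Algebra.adjoin ℂ {f})) :=
    Submodule.finiteDimensional_of_le hle
  have h2 : IsIntegral ℂ f := IsIntegral.of_mem_of_fg (Algebra.adjoin ℂ {f})
    (Module.Finite.iff_fg.mp h1) f (Algebra.self_mem_adjoin_singleton ℂ f)
  exact h2.isAlgebraic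

namespace PrimeDivisorTransfer

variable (t : PrimeDivisorTransfer X Y)

/-- The push-forward of divisors, which forgets the multiplicities of exceptional prime divisors. -/
noncomputable def divPush : Y.Divisor →+ X.Divisor := Finsupp.comapDomain.addMonoidHom t.injective

theorem divPush_apply (D : Y.Divisor) (x : X.PrimeDivisor) : t.divPush D x = D (t.σ x) := rfl

theorem map_ne_zero {f : X.RatFunc} (hf : f ≠ 0) : t.θ f ≠ 0 :=
  (map_ne_zero_iff _ t.bijective.1).mpr hf

/-- The push-forward of divisor classes. -/
noncomputable def picPush : Y.Pic →+ X.Pic :=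
  QuotientAddGroup.map _ _ t.divPush (by
    rintro D ⟨g, hg, hD⟩
    obtain ⟨f, rfl⟩ := t.bijective.2 g
    refine ⟨f, fun h => hg (by rw [h, map_zero]), fun x => ?_⟩
    rw [divPush_apply, hD, t.ordAlong_eq])

theorem picPush_divClass (D : Y.Divisor) :
    t.picPush (Y.divClass D) = X.divClass (t.divPush D) := rfl

theorem picPush_mem_effectiveMonoid {L : Y.Pic} (hL : L ∈ Y.effectiveMonoid) :
    t.picPush L ∈ X.effectiveMonoid := by
  obtain ⟨D, hD, rfl⟩ := hL
  exact ⟨t.divPush D, fun x => hD (t.σ x), rfl⟩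

theorem divPush_mapDomain (D : X.Divisor) : t.divPush (D.mapDomain t.σ) = D := by
  ext x
  rw [divPush_apply, Finsupp.mapDomain_apply t.injective]

/-- Strict transforms of effective divisors are effective. -/
theorem exists_effective_lift {L : X.Pic} (hL : L ∈ X.effectiveMonoid) :
    ∃ L' ∈ Y.effectiveMonoid, t.picPush L' = L := by
  obtain ⟨D, hD, rfl⟩ := hL
  refine ⟨Y.divClass (D.mapDomain t.σ), ⟨_, fun y => ?_, rfl⟩, ?_⟩
  · by_cases hy : y ∈ Set.range t.σ
    · obtain ⟨x, rfl⟩ := hy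
      rw [Finsupp.mapDomain_apply t.injective]
      exact hD x
    · rw [Finsupp.mapDomain_of_notMem_range _ _ hy]; rfl
  · rw [picPush_divClass, divPush_mapDomain]

theorem picPush_surjective : Function.Surjective t.picPush := by
  intro L
  obtain ⟨D, rfl⟩ := QuotientAddGroup.mk'_surjective _ L
  exact ⟨Y.divClass (D.mapDomain t.σ), by rw [picPush_divClass, divPush_mapDomain]⟩

section Exceptional

variable {e : ℕ} (E : Fin e ≃ ((Set.range t.σ)ᶜ : Set Y.PrimeDivisor))

/-- The divisor with given multiplicities along the exceptional prime divisors. -/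
noncomputable def excDiv : (Fin e → ℤ) →+ Y.Divisor :=
  (Finsupp.mapDomain.addMonoidHom fun i => (E i).1).comp
    (Finsupp.linearEquivFunOnFinite ℤ ℤ (Fin e)).symm.toAddMonoidHom

theorem excDiv_exceptional (a : Fin e → ℤ) (i : Fin e) : t.excDiv E a (E i).1 = a i :=
  Finsupp.mapDomain_apply (Subtype.val_injective.comp E.injective) _ _

theorem excDiv_σ (a : Fin e → ℤ) (x : X.PrimeDivisor) : t.excDiv E a (t.σ x) = 0 := by
  refine Finsupp.mapDomain_of_notMem_range _ _ ?_
  rintro ⟨i, hi⟩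
  exact (E i).2 ⟨x, hi.symm⟩

/-- Exceptional divisors are linearly independent in the Picard group: a rational function whose
divisor is supported on exceptional divisors of `Y` has no zeros or poles on `X`, hence is
constant. -/
theorem divClass_excDiv_injective :
    Function.Injective (Y.divClass.comp (t.excDiv E)) := by
  rw [injective_iff_map_eq_zero]
  intro a ha
  obtain ⟨g, hg, hD⟩ := (QuotientAddGroup.eq_zero_iff _).mp ha
  obtain ⟨f, rfl⟩ := t.bijective.2 g
  have hf : ∀ x, 0 ≤ X.ordAlong f x := fun x => by
    rw [← t.ordAlong_eq, ← hD, excDiv_σ]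
  have hconst := (isAlgebraic_of_forall_ordAlong_nonneg hf).algHom t.θ
  funext i
  rw [← t.excDiv_exceptional E a i, hD, ordAlong_eq_zero_of_isAlgebraic hconst]
  rfl

theorem exists_excDiv_of_picPush_eq_zero {L : Y.Pic} (hL : t.picPush L = 0) :
    ∃ a, Y.divClass (t.excDiv E a) = L := by
  obtain ⟨D, rfl⟩ := QuotientAddGroup.mk'_surjective _ L
  obtain ⟨f, hf, hD⟩ := (QuotientAddGroup.eq_zero_iff _).mp hL
  refine ⟨fun i => D (E i).1 - Y.ordAlong (t.θ f) (E i).1, ?_⟩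
  rw [← sub_eq_zero, ← neg_eq_zero, ← map_sub, ← map_neg]
  refine (QuotientAddGroup.eq_zero_iff _).mpr ⟨t.θ f, t.map_ne_zero hf, fun y => ?_⟩
  rw [Finsupp.neg_apply, Finsupp.sub_apply]
  by_cases hy : y ∈ Set.range t.σ
  · obtain ⟨x, rfl⟩ := hy
    rw [excDiv_σ, t.ordAlong_eq, ← hD, divPush_apply]
    ring
  · obtain ⟨i, hi⟩ := E.surjective ⟨y, hy⟩
    obtain rfl : (E i).1 = y := congrArg Subtype.val hi
    rw [excDiv_exceptional]
    ring

end Exceptional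

/-- Coordinates on the kernel of the push-forward, extended to `Pic Y` by means of a section, and
the lower bound for them on the effective classes with given push-forward. -/
theorem exists_exceptional_coordinates [Module.Free ℤ X.Pic] :
    ∃ (e : ℕ) (q : Y.Pic →+ (Fin e → ℤ)), (∀ L, t.picPush L = 0 → q L = 0 → L = 0) ∧
      ∀ L₀, ∃ b, ∀ L ∈ Y.effectiveMonoid, t.picPush L = L₀ → b ≤ q L := by
  have := t.finite_exceptional.to_subtype
  obtain ⟨e, ⟨E⟩⟩ := Finite.exists_equiv_fin ((Set.range t.σ)ᶜ : Set Y.PrimeDivisor)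
  replace E := E.symm
  obtain ⟨s, hs⟩ := Module.projective_lifting_property t.picPush.toIntLinearMap
    (LinearMap.id : X.Pic →ₗ[ℤ] X.Pic) t.picPush_surjective
  have hs' : ∀ L, t.picPush (s L) = L := fun L => LinearMap.congr_fun hs L
  have hq : ∀ L : Y.Pic, ∃ a, Y.divClass (t.excDiv E a) = L - s (t.picPush L) := fun L =>
    t.exists_excDiv_of_picPush_eq_zero E (by rw [map_sub, hs', sub_self])
  choose q hq using hq
  refine ⟨e, AddMonoidHom.mk' q fun L L' => t.divClass_excDiv_injective E ?_, ?_, ?_⟩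
  · rw [map_add, AddMonoidHom.comp_apply, AddMonoidHom.comp_apply, AddMonoidHom.comp_apply,
      hq, hq, hq, map_add, map_add]
    abel
  · intro L h1 h2
    have h3 := hq L
    have h2 : q L = 0 := h2
    rw [h1, map_zero, sub_zero, h2, map_zero, map_zero] at h3
    exact h3.symm
  · intro L₀
    obtain ⟨D₀, hD₀⟩ := QuotientAddGroup.mk'_surjective _ (s L₀)
    have hV : Module.Finite ℂ ((X.sections (t.divPush D₀)).map t.θ.toLinearMap) := inferInstance
    -- An effective divisor `D` over `L₀` differs from `D₀` plus an exceptional divisor by the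
    -- divisor of a function that is a section of the push-forward of `D₀`.
    choose B hB using fun i => exists_forall_ordAlong_le (E i).1
      ((X.sections (t.divPush D₀)).map t.θ.toLinearMap)
    refine ⟨fun i => - D₀ (E i).1 - B i, ?_⟩
    rintro _ ⟨D, hD, rfl⟩ hDL i
    set L := Y.divClass D with hL
    have h1 : Y.divClass (D - D₀ - t.excDiv E (q L)) = 0 := by
      rw [map_sub, map_sub, hq, hDL, sub_eq_zero]
      exact congrArg (fun u => L - u) hD₀
    obtain ⟨g, hg, hdiv⟩ := (QuotientAddGroup.eq_zero_iff _).mp h1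
    obtain ⟨f, rfl⟩ := t.bijective.2 g
    have hfs : f ∈ X.sections (t.divPush D₀) := mem_sections_iff.mpr fun _ x => by
      have := hdiv (t.σ x)
      rw [Finsupp.sub_apply, Finsupp.sub_apply, excDiv_σ, t.ordAlong_eq] at this
      rw [← this, divPush_apply, sub_zero, sub_add_cancel]
      exact hD (t.σ x)
    have h2 := hB i _ ⟨f, hfs, rfl⟩ hg
    have h3 := hdiv (E i).1
    rw [Finsupp.sub_apply, Finsupp.sub_apply, excDiv_exceptional] at h3
    have h4 : 0 ≤ D (E i).1 := hD (E i).1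
    change - D₀ (E i).1 - B i ≤ q L i
    have h5 : Y.ordAlong (t.θ f) (E i).1 ≤ B i := h2
    linarith

end PrimeDivisorTransfer

end SmoothProjectiveVariety

/-! ### Rays of the effective cone -/

theorem PointedCone.mem_hull_singleton {E : Type*} [AddCommGroup E] [Module ℝ E] {v x : E} :
    x ∈ PointedCone.hull ℝ {v} ↔ ∃ c : ℝ, 0 ≤ c ∧ c • v = x := by
  rw [PointedCone.hull, Submodule.mem_span_singleton]
  exact ⟨fun ⟨c, hc⟩ => ⟨c, c.2, hc⟩, fun ⟨c, hc, h⟩ => ⟨⟨c, hc⟩, h⟩⟩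

theorem PointedCone.hull_singleton_smul {E : Type*} [AddCommGroup E] [Module ℝ E] {c : ℝ}
    (hc : 0 < c) (v : E) : PointedCone.hull ℝ {c • v} = PointedCone.hull ℝ {v} := by
  ext x
  simp only [PointedCone.mem_hull_singleton]
  constructor
  · rintro ⟨a, ha, rfl⟩
    exact ⟨a * c, by positivity, by rw [mul_smul]⟩
  · rintro ⟨a, ha, rfl⟩
    refine ⟨a * c⁻¹, by positivity, ?_⟩
    rw [smul_smul, inv_mul_cancel_right₀ hc.ne']

namespace SmoothProjectiveVariety

variable (X : SmoothProjectiveVariety)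

theorem realClass_zero : X.realClass 0 = 0 := tmul_zero _ _

theorem realClass_add (x y : X.Pic) : X.realClass (x + y) = X.realClass x + X.realClass y :=
  tmul_add _ _ _

theorem realClass_sub (x y : X.Pic) : X.realClass (x - y) = X.realClass x - X.realClass y :=
  tmul_sub _ _ _

variable {X}

/-- Integral linear forms on `Pic X` extend to `Pic X ⊗ ℝ`. -/
theorem map_eq_of_realClass_eq_smul (f : X.Pic →+ ℤ) {x L : X.Pic} {c : ℝ}
    (h : X.realClass x = c • X.realClass L) : (f x : ℝ) = c * f L := by
  let ψ : X.PicReal →ₗ[ℤ] ℝ := TensorProduct.lift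
    ((LinearMap.mul ℤ ℝ).compl₂ ((Int.castAddHom ℝ).comp f).toIntLinearMap)
  have h1 := congrArg ψ h
  rw [realClass, realClass, smul_tmul', smul_eq_mul, mul_one] at h1
  change (1 : ℝ) * (f x : ℝ) = c * (f L : ℝ) at h1
  rwa [one_mul] at h1

/-- A free Picard group embeds into `Pic X ⊗ ℝ`. -/
theorem realClass_eq_zero_iff {m : ℕ} (φ : X.Pic ≃+ (Fin m → ℤ)) {x : X.Pic} :
    X.realClass x = 0 ↔ x = 0 := by
  refine ⟨fun h => ?_, fun h => by rw [h, realClass_zero]⟩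
  apply φ.injective
  funext i
  have := map_eq_of_realClass_eq_smul (L := 0) (c := 0)
    ((Pi.evalAddMonoidHom (fun _ : Fin m => ℤ) i).comp φ.toAddMonoidHom) (x := x)
    (by rw [h, zero_smul])
  rw [map_zero]
  simpa using this

theorem realClass_mem_effectiveCone {L : X.Pic} (hL : L ∈ X.effectiveMonoid) :
    X.realClass L ∈ X.effectiveCone :=
  subset_closure (PointedCone.subset_hull ⟨L, hL, rfl⟩)

/-- The divisor classes whose real class lies in the cone `R`. -/
def rayMonoid (R : PointedCone ℝ X.PicReal) : AddSubmonoid X.Pic where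
  carrier := {x | X.realClass x ∈ R}
  zero_mem' := by
    rw [Set.mem_ofPred_eq, realClass_zero]; exact zero_mem R
  add_mem' := fun {x y} hx hy => by
    rw [Set.mem_ofPred_eq, realClass_add]; exact add_mem hx hy

theorem mem_rayMonoid {R : PointedCone ℝ X.PicReal} {x : X.Pic} :
    x ∈ rayMonoid R ↔ X.realClass x ∈ R := Iff.rfl

/-- The classes on a ray are separated by a nonnegative integral degree, namely a coordinate that
does not vanish on the generator `L`, multiplied by its value at `L` in order to make it
nonnegative. -/
theorem exists_grading_rayMonoid {m : ℕ} (φ : X.Pic ≃+ (Fin m → ℤ)) {L : X.Pic}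
    (hL : X.realClass L ≠ 0) : ∃ d : X.Pic →+ ℤ,
      (∀ x ∈ rayMonoid (PointedCone.hull ℝ {X.realClass L}), 0 ≤ d x) ∧
      ∀ x ∈ rayMonoid (PointedCone.hull ℝ {X.realClass L}),
        ∀ y ∈ rayMonoid (PointedCone.hull ℝ {X.realClass L}), d x = d y → x = y := by
  obtain ⟨i, hi⟩ : ∃ i, φ L i ≠ 0 := by
    by_contra! h
    refine hL ((realClass_eq_zero_iff φ).mpr (φ.injective ?_))
    rw [map_zero]
    exact funext h
  let coord : Fin m → X.Pic →+ ℤ := fun j =>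
    (Pi.evalAddMonoidHom (fun _ : Fin m => ℤ) j).comp φ.toAddMonoidHom
  have hd : ∀ x, ∀ c : ℝ, c • X.realClass L = X.realClass x → ∀ j, (φ x j : ℝ) = c * φ L j :=
    fun x c h j => map_eq_of_realClass_eq_smul (coord j) h.symm
  refine ⟨(φ L i) • coord i, fun x hx => ?_, fun x hx y hy hxy => ?_⟩
  · obtain ⟨c, hc, h⟩ := PointedCone.mem_hull_singleton.mp hx
    have h1 := hd x c h i
    have h2 : (0 : ℝ) ≤ (φ L i * φ x i : ℤ) := by
      push_cast
      rw [h1]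
      nlinarith [mul_self_nonneg (φ L i : ℝ)]
    exact_mod_cast h2
  · obtain ⟨c, hc, h⟩ := PointedCone.mem_hull_singleton.mp hx
    obtain ⟨c', hc', h'⟩ := PointedCone.mem_hull_singleton.mp hy
    have hxy : φ L i * φ x i = φ L i * φ y i := hxy
    have h3 : φ x i = φ y i := mul_left_cancel₀ hi hxy
    have h4 : (c - c') * φ L i = 0 := by
      rw [sub_mul, ← hd x c h i, ← hd y c' h' i, h3, sub_self]
    have h5 : c = c' := sub_eq_zero.mp
      ((mul_eq_zero.mp h4).resolve_right (by exact_mod_cast hi))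
    apply φ.injective
    funext j
    have h6 : (φ x j : ℝ) = φ y j := by rw [hd x c h j, hd y c' h' j, h5]
    exact_mod_cast h6

/-- A nonzero difference of two classes on a ray, or its negative, generates the ray. -/
theorem eq_hull_of_sub_mem {L x y : X.Pic}
    (hx : x ∈ rayMonoid (PointedCone.hull ℝ {X.realClass L}))
    (hy : y ∈ rayMonoid (PointedCone.hull ℝ {X.realClass L}))
    (hxy : X.realClass (x - y) ≠ 0) :
    PointedCone.hull ℝ {X.realClass L} = PointedCone.hull ℝ {X.realClass (x - y)} ∨
      PointedCone.hull ℝ {X.realClass L} = PointedCone.hull ℝ {-X.realClass (x - y)} := by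
  obtain ⟨c, -, h⟩ := PointedCone.mem_hull_singleton.mp hx
  obtain ⟨c', -, h'⟩ := PointedCone.mem_hull_singleton.mp hy
  have h1 : X.realClass (x - y) = (c - c') • X.realClass L := by
    rw [realClass_sub, ← h, ← h', sub_smul]
  rcases lt_trichotomy (c - c') 0 with hlt | heq | hgt
  · right
    rw [h1, ← neg_smul, PointedCone.hull_singleton_smul (neg_pos.mpr hlt)]
  · rw [heq, zero_smul] at h1
    exact (hxy h1).elim
  · left
    rw [h1, PointedCone.hull_singleton_smul hgt]

/-- Each element of the finite set `T` of `MonoidSeries.isTranscendental_of_faces` excludes at most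
two rays. -/
theorem isTranscendental_eulerChow_of_transfer {Y : SmoothProjectiveVariety} {m : ℕ}
    (φ : X.Pic ≃+ (Fin m → ℤ))
    (hrays : {R : PointedCone ℝ X.PicReal | X.IsEffectiveExtremeRay R}.Infinite)
    (t : PrimeDivisorTransfer X Y) : MonoidSeries.IsTranscendental Y.eulerChow := by
  have : Module.Free ℤ X.Pic := Module.Free.of_equiv φ.symm.toIntLinearEquiv
  obtain ⟨e, q, hq, hbdd⟩ := t.exists_exceptional_coordinates
  refine MonoidSeries.isTranscendental_of_faces t.picPush q X.effectiveMonoid hq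
    (fun L hL => t.picPush_mem_effectiveMonoid hL) hbdd fun T hT => ?_
  have hfin : (⋃ h ∈ T, ({PointedCone.hull ℝ {X.realClass h},
      PointedCone.hull ℝ {-X.realClass h}} : Set (PointedCone ℝ X.PicReal))).Finite :=
    T.finite_toSet.biUnion fun h _ => Set.toFinite _
  obtain ⟨_, ⟨hface, L, hL, hL0, rfl⟩, hRT⟩ := hrays.exists_notMem_finite hfin
  obtain ⟨d, hd, hinj⟩ := exists_grading_rayMonoid φ hL0
  obtain ⟨L', hL', rfl⟩ := t.exists_effective_lift hL
  refine ⟨rayMonoid (PointedCone.hull ℝ {X.realClass (t.picPush L')}), d, hd, hinj, ?_, ?_,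
    ⟨L', hL'⟩, ?_, ?_, ?_⟩
  · intro x hx y hy hxy
    rw [mem_rayMonoid, realClass_add] at hxy
    exact hface.mem_of_add_mem_left (realClass_mem_effectiveCone hx)
      (realClass_mem_effectiveCone hy) hxy
  · intro x hx y hy hmem
    refine hRT (Set.mem_biUnion hmem ?_)
    refine eq_hull_of_sub_mem hx hy fun h0 => hT ?_
    rwa [← (realClass_eq_zero_iff φ).mp h0]
  · exact PointedCone.subset_hull rfl
  · exact fun h => hL0 (by rw [show t.picPush L' = 0 from h, realClass_zero])
  · exact Nat.cast_ne_zero.mpr (h0_ne_zero_of_mem hL')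

theorem isBirationalMorphism_id : IsBirationalMorphism (𝟙 X.scheme) :=
  ⟨Category.id_comp _, .refl _, (Category.id_comp _).trans (Category.comp_id _).symm⟩

end SmoothProjectiveVariety

theorem corollary3p2 (X : SmoothProjectiveVariety) (m : ℕ)
    (hPic : Nonempty (X.Pic ≃+ (Fin m → ℤ)))
    (hrays : {R : PointedCone ℝ X.PicReal | X.IsEffectiveExtremeRay R}.Infinite) :
    MonoidSeries.IsTranscendental X.eulerChow ∧
      ∀ (Y : SmoothProjectiveVariety) (π : Y.scheme ⟶ X.scheme),
        SmoothProjectiveVariety.IsBirationalMorphism π →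
          MonoidSeries.IsTranscendental Y.eulerChow := by
  obtain ⟨φ⟩ := hPic
  have key : ∀ (Y : SmoothProjectiveVariety) (π : Y.scheme ⟶ X.scheme),
      SmoothProjectiveVariety.IsBirationalMorphism π →
        MonoidSeries.IsTranscendental Y.eulerChow := fun Y π hπ => by
    obtain ⟨t⟩ := hπ.nonempty_primeDivisorTransfer
    exact SmoothProjectiveVariety.isTranscendental_eulerChow_of_transfer φ hrays t
  exact ⟨key X (𝟙 X.scheme) SmoothProjectiveVariety.isBirationalMorphism_id, key⟩
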